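/- Conventions. A simplicial complex $(\Delta,X)$ is a finite set $X$ (the ground set) with a family $\Delta$ of subsets of $X$ (the faces) closed under taking subsets; elements of $X$ need not be vertices (a vertex is an $x$ with $\{x\}\in\Delta$). The void complex has no faces; it is distinct from $\{\emptyset\}$. For $x\in X$, the deletion and the link are the complexes on $X\setminus\{x\}$ given by $\operatorname{dl}_x(\Delta)=\{\sigma\in\Delta: x\notin\sigma\}$ and $\operatorname{lk}_x(\Delta)=\{\sigma : x\notin\sigma,\ \sigma\cup\{x\}\in\Delta\}$. A complex on $X$ is a cone if it has the form $\{\sigma\cup\rho:\sigma\in\Gamma,\ \rho\in\{\emptyset,\{x\}\}\}$ for some $x\in X$ and some simplicial complex $\Gamma$ no face of which contains $x$ ($\Gamma$ may be void). A complex $(\Delta,X)$ is (recursively) a strong combinatorial grape if it has at most one vertex, or if there is $a\in X$ such that at least one of $\operatorname{lk}_a(\Delta)$, $\operatorname{dl}_a(\Delta)$ is a cone and both are strong combinatorial grapes. An elementary collapse removes from $\Delta$ a maximal face $\sigma$ and a face $\tau\subset\sigma$ with $|\tau|=|\sigma|-1$ such that $\sigma$ is the only face properly containing $\tau$; its inverse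 is an elementary expansion; two complexes are simple-homotopy equivalent if, up to relabelling of vertices, they are related by a finite sequence of elementary collapses and expansions. $\partial\beta_n$ is the boundary of the $n$-dimensional cross-polytope, i.e. the join of $n$ copies of $S^0$ (two points); $\partial\beta_0=\{\emptyset\}$. Let $G=(V,E)$ be a finite simple graph. Let $\gamma(G)$, $i(G)$ and $\alpha_0(G)$ be the minimum cardinality of, respectively, a dominating set, an independent dominating set, and a vertex cover of $G$. Let $\operatorname{Ind}(G)$ be the complex on $V$ whose faces are the independent sets; $\operatorname{Dom}(G)$ the complex on $V$ whose faces are the $F\subseteq V$ such that $V\setminus F$ is dominating; $\operatorname{EC}(G)$ the complex on $E$ whose faces are the $F\subseteq E$ such that every vertex is an endpoint of some edge in $E\setminus F$; and $\operatorname{ED}(G)$ the complex on $E$ whose faces are the $F\subseteq E$ such that every $e\in E$ has a common endpoint with some $e'\in E\setminus F$ (where $e'=e$ is allowed). Theorem. Let $G=(V,E)$ be a finite forest. Then $\operatorname{Ind}(G)$, $\operatorname{Dom}(G)$, $\operatorname{EC}(G)$ and $\operatorname{ED}(G)$ are all strong combinatorial grapes. Moreover: 1. $\operatorname{Ind}(G)$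 is simple-homotopy equivalent to either the void complex or $\partial\beta_{i(G)}$, and in the latter case $i(G)=\gamma(G)$; 2. $\operatorname{Dom}(G)$ is simple-homotopy equivalent to $\partial\beta_{\alpha_0(G)}$; 3. $|E|-|V|+i(G)\ge 0$, and $\operatorname{EC}(G)$ is simple-homotopy equivalent to either the void complex or $\partial\beta_{|E|-|V|+i(G)}$, and in the latter case $i(G)=\gamma(G)$; 4. $|E|-\alpha_0(G)\ge 0$, and $\operatorname{ED}(G)$ is simple-homotopy equivalent to $\partial\beta_{|E|-\alpha_0(G)}$. -/

import Mathlib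

/-- A finite simplicial complex with a ground set. The empty face is recorded explicitly, so the
void complex (no face at all) and the irrelevant complex (only the empty face) are different.
Elements of the ground set need not be vertices. Mathlib's `AbstractSimplicialComplex` excludes the
empty face, hence cannot be used here. -/
structure GroundedComplex (α : Type*) where
  ground : Finset α
  faces : Set (Finset α)
  subset_ground : ∀ σ ∈ faces, σ ⊆ ground
  down_closed : ∀ σ ∈ faces, ∀ τ ⊆ σ, τ ∈ faces

namespace GroundedComplex

variable {α : Type*}

/-- The void complex. -/
def void (α : Type*) : GroundedComplex α where
  ground := ∅
  faces := ∅
  subset_ground := by simp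
  down_closed := by simp

/-- The boundary of the `n`-dimensional cross-polytope, i.e. the `n`-fold join of `S⁰`: the vertices
are `n` pairs of antipodal points, and a face contains no antipodal pair. For `n = 0` this is the
irrelevant complex. -/
def crossPolytopeBoundary (n : ℕ) : GroundedComplex (Fin n × Bool) where
  ground := Finset.univ
  faces := {σ | ∀ i, ¬ ((i, false) ∈ σ ∧ (i, true) ∈ σ)}
  subset_ground := fun σ _ => Finset.subset_univ σ
  down_closed := fun _ hσ _ hτ i h => hσ i ⟨hτ h.1, hτ h.2⟩

/-- `F'` arises from the simplicial complex with family of faces `F` by an elementary collapse: the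
removal of a maximal face `σ` and of a codimension-one face `τ` of `σ` such that `σ` is the only
face properly containing `τ`. -/
def ElementaryCollapse (F F' : Set (Finset α)) : Prop :=
  IsLowerSet F ∧ ∃ σ ∈ F, ∃ τ, (∀ ρ ∈ F, σ ⊆ ρ → ρ = σ) ∧ τ ⊆ σ ∧ τ.card + 1 = σ.card ∧
    (∀ ρ ∈ F, τ ⊂ ρ → ρ = σ) ∧ F' = F \ {σ, τ}

/-- Simple-homotopy equivalence: after an injective relabelling of the two ground sets by elements
of a common infinite set of labels, the two families of faces are related by a finite sequence of
elementary collapses and elementary expansions. Ground sets play no further role. -/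
def SimpleHomotopyEquiv {β : Type*} (K : GroundedComplex α) (L : GroundedComplex β) : Prop :=
  ∃ (f : α → ℕ) (g : β → ℕ), Set.InjOn f K.ground ∧ Set.InjOn g L.ground ∧
    Relation.EqvGen ElementaryCollapse
      (Finset.image f '' K.faces) (Finset.image g '' L.faces)

variable [DecidableEq α]

/-- The deletion of `x`, on the ground set without `x`. -/
def deletion (K : GroundedComplex α) (x : α) : GroundedComplex α where
  ground := K.ground.erase x
  faces := {σ | σ ∈ K.faces ∧ x ∉ σ}
  subset_ground := fun σ hσ => Finset.subset_erase.2 ⟨K.subset_ground σ hσ.1, hσ.2⟩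
  down_closed := fun σ hσ τ hτ => ⟨K.down_closed σ hσ.1 τ hτ, fun h => hσ.2 (hτ h)⟩

/-- The link of `x`, on the ground set without `x`. -/
def link (K : GroundedComplex α) (x : α) : GroundedComplex α where
  ground := K.ground.erase x
  faces := {σ | x ∉ σ ∧ insert x σ ∈ K.faces}
  subset_ground := fun σ hσ => Finset.subset_erase.2
    ⟨(Finset.subset_insert x σ).trans (K.subset_ground _ hσ.2), hσ.1⟩
  down_closed := fun _ hσ _ hτ => ⟨fun h => hσ.1 (hτ h),
    K.down_closed _ hσ.2 _ (Finset.insert_subset_insert x hτ)⟩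

/-- The join of two families of faces. -/
def joinFaces (F G : Set (Finset α)) : Set (Finset α) :=
  {σ | ∃ m₁ ∈ F, ∃ m₂ ∈ G, σ = m₁ ∪ m₂}

/-- `K` is a cone: for some apex `x` in the ground set, it is the join of `{∅, {x}}` with a complex
none of whose faces contains `x`. (The void complex on a nonempty ground set is a cone.) -/
def IsCone (K : GroundedComplex α) : Prop :=
  ∃ x ∈ K.ground, ∃ L : GroundedComplex α, (∀ σ ∈ L.faces, x ∉ σ) ∧
    K.faces = joinFaces L.faces {∅, {x}}

/-- Strong combinatorial grapes, defined recursively (the ground set shrinks at each step). -/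
inductive IsStrongCombinatorialGrape : GroundedComplex α → Prop
  | of_atMostOneVertex (K : GroundedComplex α)
      (h : ∀ x y, {x} ∈ K.faces → {y} ∈ K.faces → x = y) : IsStrongCombinatorialGrape K
  | of_link_deletion (K : GroundedComplex α) (a : α) (ha : a ∈ K.ground)
      (hcone : (K.link a).IsCone ∨ (K.deletion a).IsCone)
      (hdl : IsStrongCombinatorialGrape (K.deletion a))
      (hlk : IsStrongCombinatorialGrape (K.link a)) : IsStrongCombinatorialGrape K

end GroundedComplex

namespace SimpleGraph

variable {V : Type*} (G : SimpleGraph V)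

/-- `D` is dominating: its closed neighbourhood is the whole vertex set. -/
def IsDominatingSet (D : Finset V) : Prop :=
  ∀ v, ∃ d ∈ D, d = v ∨ G.Adj d v

/-- The domination number `γ(G)` (for finite graphs). -/
noncomputable def dominationNum : ℕ :=
  sInf {k | ∃ D : Finset V, G.IsDominatingSet D ∧ D.card = k}

/-- The independent domination number `i(G)` (for finite graphs). -/
noncomputable def indepDominationNum : ℕ :=
  sInf {k | ∃ D : Finset V, G.IsIndepSet D ∧ G.IsDominatingSet D ∧ D.card = k}

variable [Fintype V]

/-- The independence complex `Ind(G)`. -/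
def independenceComplex : GroundedComplex V where
  ground := Finset.univ
  faces := {F | G.IsIndepSet F}
  subset_ground := fun F _ => Finset.subset_univ F
  down_closed := fun _ hF _ hF' => Set.Pairwise.mono (Finset.coe_subset.2 hF') hF

variable [DecidableEq V]

/-- The dominance complex `Dom(G)`: the complement of a face is dominating. -/
def dominanceComplex : GroundedComplex V where
  ground := Finset.univ
  faces := {F | G.IsDominatingSet (Finset.univ \ F)}
  subset_ground := fun F _ => Finset.subset_univ F
  down_closed := fun _ hF _ hF' v =>
    let ⟨d, hd, h⟩ := hF v
    ⟨d, Finset.sdiff_subset_sdiff subset_rfl hF' hd, h⟩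

variable [DecidableRel G.Adj]

/-- The edge covering complex `EC(G)`: the complement of a face is an edge cover. -/
def edgeCoveringComplex : GroundedComplex (Sym2 V) where
  ground := G.edgeFinset
  faces := {F | F ⊆ G.edgeFinset ∧ ∀ v : V, ∃ e ∈ G.edgeFinset \ F, v ∈ e}
  subset_ground := fun _ hF => hF.1
  down_closed := fun _ hF _ hF' => ⟨hF'.trans hF.1, fun v =>
    let ⟨e, he, h⟩ := hF.2 v
    ⟨e, Finset.sdiff_subset_sdiff subset_rfl hF' he, h⟩⟩

/-- The edge dominance complex `ED(G)`: every edge meets (possibly equals) some edge in the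
complement of a face. -/
def edgeDominanceComplex : GroundedComplex (Sym2 V) where
  ground := G.edgeFinset
  faces := {F | F ⊆ G.edgeFinset ∧
    ∀ e ∈ G.edgeFinset, ∃ e' ∈ G.edgeFinset \ F, ∃ v, v ∈ e' ∧ v ∈ e}
  subset_ground := fun _ hF => hF.1
  down_closed := fun _ hF _ hF' => ⟨hF'.trans hF.1, fun e he =>
    let ⟨e', he', h⟩ := hF.2 e he
    ⟨e', Finset.sdiff_subset_sdiff subset_rfl hF' he', h⟩⟩

end SimpleGraph

/-!
All four complexes are covering complexes: for a relation `R` between the ground set `A` and a set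
`C` of constraints, the faces are the `F ⊆ A` such that every `c ∈ C` is related to an element of
`A` outside `F`. Links and deletions of covering complexes are covering complexes (with smaller `A`
and `C`), and the following observation does all the work: if `a ≠ v` meets every constraint that
`v` meets, then the deletion of `a` is a cone with apex `v`.

*Grapes.* In a forest, leaves provide such a pair `a, v`, or else a constraint met by only one
element `a`, in which case the link of `a` is void. This persists for all smaller `A` and `C`
(`isStrongCombinatorialGrape_coveringComplex`). For the edge dominance complex the end `y` of the
pendant edge has to be chosen so that all but one of its neighbours are leaves
(`IsAcyclic.exists_penultimate`).

*Homotopy types.* If the deletion of `a` is a cone, the complex is simple-homotopy equivalent to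
the suspension of the link of `a` (`exists_eqvGen_suspension_link`). All collapses come from
one criterion: a complex collapses to a subcomplex if the faces outside the subcomplex are matched
by adding and removing one fixed vertex (`eqvGen_elementaryCollapse_of_matching`).
Let `v` be a leaf with neighbour `w`, and let `d` be the degree of `w`.

* The dominance complex is the suspension of that of `G - {v, w}`, and the edge dominance complex is
  the `(d - 1)`-fold suspension of that of `G - {v, w}`. Meanwhile the vertex cover number drops by
  one and the number of edges by `d` (`IsAcyclic.exists_sphereType_dominance`).
* The independence complex is the suspension of that of `G - N[w]`, and the edge covering complex is
  an iterated suspension of that of `G - N[w]`, with one suspension for each edge not at `w` that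
  meets the neighbourhood of `w`. The process ends either with an isolated vertex, and then the
  independence complex is a cone and the edge covering complex is void, or with the empty
  graph after `k` steps. In the latter case the vertices `w` form an independent dominating set with
  `k` elements, and a greedy exchange argument shows that every dominating set has at least `k`
  elements, so that `i(G) = γ(G) = k` (`IsAcyclic.exists_sphereType_independence`).

Finally, the two alternatives exclude each other, as collapses preserve the parity of the
number of faces, which is even for the void complex and odd for the boundary of a cross-polytope.
-/

namespace GroundedComplex

variable {α γ : Type*}

/-! ### Collapses along a matching -/

/-- If the faces of `F` outside the subcomplex `F'` are matched by adding and removing a single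
vertex `x`, then `F` collapses to `F'`: a largest face of `F` outside `F'` contains `x`, and
together with its facet opposite to `x` it can be removed by an elementary collapse. -/
theorem eqvGen_elementaryCollapse_of_matching [DecidableEq α] {F' : Set (Finset α)}
    (hF' : IsLowerSet F') (x : α) (F : Set (Finset α)) (hF : IsLowerSet F) (hsub : F' ⊆ F)
    (hfin : (F \ F').Finite)
    (hins : ∀ σ ∈ F, σ ∉ F' → insert x σ ∈ F) (her : ∀ σ ∈ F, σ ∉ F' → σ.erase x ∉ F') :
    Relation.EqvGen ElementaryCollapse F F' := by
  induction hn : (F \ F').ncard using Nat.strong_induction_on generalizing F with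
  | _ n ih =>
  by_cases hne : (F \ F').Nonempty
  · obtain ⟨σ, hσ, hmax⟩ := Set.exists_max_image (F \ F') Finset.card hfin hne
    have hins' : ∀ ρ ∈ F \ F', insert x ρ ∈ F \ F' := fun ρ hρ =>
      ⟨hins ρ hρ.1 hρ.2, fun h => hρ.2 (hF' (Finset.subset_insert x ρ) h)⟩
    have hx : x ∈ σ := by
      by_contra hx
      have := hmax _ (hins' σ hσ)
      rw [Finset.card_insert_of_notMem hx] at this
      omega
    have hτ : σ.erase x ∉ F' := her σ hσ.1 hσ.2
    have hfac : ∀ ρ ∈ F, σ.erase x ⊆ ρ → ρ = σ ∨ ρ = σ.erase x := by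
      intro ρ hρ hle
      have hρ' : ρ ∈ F \ F' := ⟨hρ, fun h => hτ (hF' hle h)⟩
      have h1 : σ = insert x ρ := by
        refine Finset.eq_of_subset_of_card_le ?_ (hmax _ (hins' ρ hρ'))
        rw [← Finset.insert_erase hx]
        exact Finset.insert_subset_insert x hle
      by_cases hxρ : x ∈ ρ
      · exact Or.inl (by rw [h1, Finset.insert_eq_of_mem hxρ])
      · exact Or.inr (by rw [h1, Finset.erase_insert hxρ])
    have hsubset : σ.erase x ⊆ σ := Finset.erase_subset x σ
    have hstep : ElementaryCollapse F (F \ {σ, σ.erase x}) := by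
      refine ⟨hF, σ, hσ.1, σ.erase x, ?_, hsubset, Finset.card_erase_add_one hx, ?_, rfl⟩
      · intro ρ hρ hle
        rcases hfac ρ hρ (hsubset.trans hle) with h | h
        · exact h
        · exact absurd (hle hx) (by simp [h])
      · intro ρ hρ hlt
        exact (hfac ρ hρ hlt.1).resolve_right fun h => hlt.ne h.symm
    have hdiff : (F \ {σ, σ.erase x}) \ F' ⊂ F \ F' :=
      ⟨fun ρ hρ => ⟨hρ.1.1, hρ.2⟩, fun h => (h hσ).1.2 (by simp)⟩
    refine .trans _ _ _ (.rel _ _ hstep) (ih _ ?_ _ ?_ ?_ (hfin.subset hdiff.1) ?_ ?_ rfl)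
    · rw [← hn]
      exact Set.ncard_lt_ncard hdiff hfin
    · intro ρ κ hle hρ
      refine ⟨hF hle hρ.1, fun h => hρ.2 ?_⟩
      have : σ.erase x ⊆ ρ := by
        rcases h with h | h
        · exact (hsubset.trans h.symm.subset).trans hle
        · exact Eq.subset (Set.mem_singleton_iff.1 h).symm |>.trans hle
      exact hfac ρ hρ.1 this
    · intro ρ hρ
      refine ⟨hsub hρ, ?_⟩
      rintro (rfl | h)
      · exact hσ.2 hρ
      · exact hτ (Set.mem_singleton_iff.1 h ▸ hρ)
    · intro ρ hρ hρ'
      refine ⟨hins ρ hρ.1 hρ', fun h => hρ.2 ?_⟩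
      refine hfac ρ hρ.1 ?_
      rcases h with h | h
      · rw [← h]
        exact Finset.erase_insert_subset x ρ
      · exact absurd (Finset.mem_insert_self x ρ) (by rw [Set.mem_singleton_iff.1 h]; simp)
    · exact fun ρ hρ hρ' => her ρ hρ.1 hρ'
  · have : F = F' := by
      refine Set.Subset.antisymm (fun σ hσ => ?_) hsub
      by_contra h
      exact hne ⟨σ, hσ, h⟩
    rw [this]
    exact .refl _

/-! ### The parity of the number of faces -/

/-- An elementary collapse removes exactly two faces. -/
theorem even_ncard_iff_of_eqvGen {F F' : Set (Finset α)}
    (h : Relation.EqvGen ElementaryCollapse F F') : Even F.ncard ↔ Even F'.ncard := by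
  induction h with
  | rel F F' h =>
    obtain ⟨hF, σ, hσ, τ, -, hτσ, hcard, -, rfl⟩ := h
    have hne : σ ≠ τ := by rintro rfl; omega
    have hsub : ({σ, τ} : Set (Finset α)) ⊆ F := by
      rintro ρ (rfl | h)
      · exact hσ
      · exact hF (by rw [Set.mem_singleton_iff.1 h]; exact hτσ) hσ
    have hpair : ({σ, τ} : Set (Finset α)).Finite := Set.toFinite _
    by_cases hfin : F.Finite
    · rw [← Set.ncard_sdiff_add_ncard_of_subset hsub hfin, Set.ncard_pair hne]
      simp [Nat.even_add]
    · -- `Set.ncard` of an infinite family is zero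
      rw [Set.Infinite.ncard hfin, Set.Infinite.ncard]
      exact fun h => hfin ((h.union hpair).subset (by
        rw [Set.sdiff_union_self]
        exact Set.subset_union_left))
  | refl => rfl
  | symm _ _ _ ih => exact ih.symm
  | trans _ _ _ _ _ ih₁ ih₂ => exact ih₁.trans ih₂

/-- Swapping all antipodal pairs is an involution of the faces of the boundary of the
cross-polytope, and it fixes only the empty face. -/
theorem odd_ncard_crossPolytopeBoundary (n : ℕ) : Odd (crossPolytopeBoundary n).faces.ncard := by
  classical
  set e : Fin n × Bool → Fin n × Bool := fun p => (p.1, !p.2) with he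
  have hee : ∀ p, e (e p) = p := fun p => by simp [he]
  have hmem : ∀ (σ : Finset (Fin n × Bool)) p, p ∈ σ.image e ↔ e p ∈ σ := fun σ p => by
    rw [Finset.mem_image]
    exact ⟨fun ⟨q, hq, h⟩ => by rwa [← h, hee], fun h => ⟨_, h, hee p⟩⟩
  have hfin : (crossPolytopeBoundary n).faces.Finite := Set.toFinite _
  have hempty : (∅ : Finset (Fin n × Bool)) ∈ hfin.toFinset := by
    simp [crossPolytopeBoundary]
  have hsum : ∑ _σ ∈ hfin.toFinset.erase ∅, (1 : ZMod 2) = 0 := by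
    refine Finset.sum_involution (fun σ _ => σ.image e) (fun _ _ => by decide) ?_ ?_ ?_
    · intro σ hσ _ heq
      rw [Finset.mem_erase, Set.Finite.mem_toFinset] at hσ
      obtain ⟨⟨i, b⟩, hp⟩ := Finset.nonempty_iff_ne_empty.2 hσ.1
      have hp' : (i, !b) ∈ σ := by
        have := (hmem σ (i, !b)).2 (by simpa [he] using hp)
        rwa [heq] at this
      cases b
      · exact hσ.2 i ⟨hp, hp'⟩
      · exact hσ.2 i ⟨hp', hp⟩
    · intro σ hσ
      rw [Finset.mem_erase, Set.Finite.mem_toFinset] at hσ ⊢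
      refine ⟨by simpa using hσ.1, fun i h => hσ.2 i ?_⟩
      rw [hmem, hmem] at h
      exact ⟨h.2, h.1⟩
    · intro σ _
      ext p
      rw [hmem, hmem, hee]
  rw [Set.ncard_eq_toFinset_card _ hfin, ← Finset.card_erase_add_one hempty]
  rw [Finset.sum_const, nsmul_one, ZMod.natCast_eq_zero_iff_even] at hsum
  exact hsum.add_one

theorem ncard_image_faces [DecidableEq α] {β : Type*} [DecidableEq β] (K : GroundedComplex α)
    {f : α → β} (hf : Set.InjOn f K.ground) :
    (Finset.image f '' K.faces).ncard = K.faces.ncard := by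
  refine Set.InjOn.ncard_image fun σ hσ τ hτ h => ?_
  exact Finset.coe_injective <| (hf.image_eq_image_iff (K.subset_ground σ hσ)
    (K.subset_ground τ hτ)).1 (by simpa using congrArg ((↑) : Finset β → Set β) h)

/-- A complex cannot be simple-homotopy equivalent both to the void complex and to the boundary of
a cross-polytope. -/
theorem not_simpleHomotopyEquiv_crossPolytopeBoundary {β : Type*} {K : GroundedComplex α}
    (h : K.SimpleHomotopyEquiv (void β)) (n : ℕ) :
    ¬ K.SimpleHomotopyEquiv (crossPolytopeBoundary n) := by
  classical
  rintro ⟨f, g, hf, hg, hfg⟩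
  obtain ⟨f', g', hf', -, hfg'⟩ := h
  have h1 := even_ncard_iff_of_eqvGen hfg
  have h2 := even_ncard_iff_of_eqvGen hfg'
  rw [ncard_image_faces K hf, ncard_image_faces _ hg] at h1
  rw [ncard_image_faces K hf'] at h2
  have h3 := h1.1 (h2.2 (by simp [void]))
  exact (Nat.not_even_iff_odd.2 (odd_ncard_crossPolytopeBoundary n)) h3

/-! ### Suspensions -/

/-- The preimage of a set of labels under the shift `i ↦ i + 2`; the labels `0` and `1`, which are
used as suspension points, are forgotten. -/
noncomputable def tail (σ : Finset ℕ) : Finset ℕ :=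
  σ.preimage (· + 2) (add_left_injective 2).injOn

@[simp]
theorem mem_tail {σ : Finset ℕ} {i : ℕ} : i ∈ tail σ ↔ i + 2 ∈ σ := by
  simp [tail]

theorem tail_mono {σ τ : Finset ℕ} (h : σ ⊆ τ) : tail σ ⊆ tail τ := fun i hi => by
  rw [mem_tail] at hi ⊢
  exact h hi

theorem tail_insert_add_two (σ : Finset ℕ) (x : ℕ) :
    tail (insert (x + 2) σ) = insert x (tail σ) := by
  ext i
  simp

theorem tail_erase_add_two (σ : Finset ℕ) (x : ℕ) :
    tail (σ.erase (x + 2)) = (tail σ).erase x := by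
  ext i
  simp

theorem eq_of_tail_eq {σ τ : Finset ℕ} (h : tail σ = tail τ) (h0 : 0 ∈ σ ↔ 0 ∈ τ)
    (h1 : 1 ∈ σ ↔ 1 ∈ τ) : σ = τ := by
  ext i
  match i with
  | 0 => exact h0
  | 1 => exact h1
  | i + 2 => rw [← mem_tail, h, mem_tail]

/-- The suspension of a family of faces on the labels `ℕ`: after shifting all labels by two, the
join with the two points `0` and `1`. -/
def suspension (X : Set (Finset ℕ)) : Set (Finset ℕ) :=
  {σ | tail σ ∈ X ∧ ¬ (0 ∈ σ ∧ 1 ∈ σ)}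

theorem suspension_empty : suspension ∅ = ∅ := by
  ext σ
  simp [suspension]

theorem isLowerSet_suspension {X : Set (Finset ℕ)} (hX : IsLowerSet X) :
    IsLowerSet (suspension X) :=
  fun _ _ hle hσ => ⟨hX (tail_mono hle) hσ.1, fun h => hσ.2 ⟨hle h.1, hle h.2⟩⟩

theorem eqvGen_suspension {X Y : Set (Finset ℕ)} (h : Relation.EqvGen ElementaryCollapse X Y) :
    Relation.EqvGen ElementaryCollapse (suspension X) (suspension Y) := by
  induction h with
  | rel X Y h =>
    obtain ⟨hX, σ, hσ, τ, hmax, hτσ, hcard, hτ, rfl⟩ := h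
    have hY : IsLowerSet (X \ {σ, τ}) := by
      intro ρ κ hle hρ
      refine ⟨hX hle hρ.1, ?_⟩
      rintro (rfl | h)
      · exact hρ.2 (Or.inl (hmax ρ hρ.1 hle))
      · obtain rfl : κ = τ := h
        rcases eq_or_ssubset_of_subset hle with h | h
        · exact hρ.2 (Or.inr h.symm)
        · exact hρ.2 (Or.inl (hτ ρ hρ.1 h))
    -- `σ` and `τ` differ by a single vertex `x`, along which the suspension is matched
    obtain ⟨x, hx⟩ : ∃ x, σ \ τ = {x} := by
      rw [← Finset.card_eq_one, Finset.card_sdiff_of_subset hτσ]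
      omega
    have hxσ : x ∈ σ ∧ x ∉ τ := by
      rw [← Finset.mem_sdiff, hx]
      exact Finset.mem_singleton_self x
    have hins : insert x τ = σ := by
      rw [Finset.insert_eq, ← hx, Finset.sdiff_union_of_subset hτσ]
    have hout : ∀ ρ ∈ suspension X, ρ ∉ suspension (X \ {σ, τ}) → tail ρ = σ ∨ tail ρ = τ := by
      intro ρ hρ hρ'
      by_contra hne
      exact hρ' ⟨⟨hρ.1, hne⟩, hρ.2⟩
    refine eqvGen_elementaryCollapse_of_matching (isLowerSet_suspension hY) (x + 2) _
      (isLowerSet_suspension hX) (fun ρ hρ => ⟨hρ.1.1, hρ.2⟩) ?_ ?_ ?_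
    · refine Set.Finite.of_finite_image (f := fun ρ => (tail ρ, (decide (0 ∈ ρ), decide (1 ∈ ρ))))
        ((Set.Finite.prod (Set.toFinite {σ, τ}) (Set.finite_univ)).subset ?_) ?_
      · rintro _ ⟨ρ, hρ, rfl⟩
        exact ⟨hout ρ hρ.1 hρ.2, trivial⟩
      · intro ρ _ κ _ h
        simp only [Prod.mk.injEq, decide_eq_decide] at h
        exact eq_of_tail_eq h.1 h.2.1 h.2.2
    · intro ρ hρ hρ'
      refine ⟨?_, by simpa using hρ.2⟩
      rw [tail_insert_add_two]
      rcases hout ρ hρ hρ' with h | h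
      · rwa [h, Finset.insert_eq_of_mem hxσ.1]
      · rwa [h, hins]
    · intro ρ hρ hρ' h
      refine h.1.2 (Or.inr ?_)
      rw [tail_erase_add_two]
      rcases hout ρ hρ hρ' with h | h
      · rw [h, ← hins, Finset.erase_insert hxσ.2]
        rfl
      · rw [h, Finset.erase_eq_of_notMem hxσ.2]
        rfl
  | refl => exact .refl _
  | symm _ _ _ ih => exact .symm _ _ ih
  | trans _ _ _ _ _ ih₁ ih₂ => exact .trans _ _ _ ih₁ ih₂

/-- Let `P` be a complex on labels different from `1` such that the deletion of the vertex `0` is a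
cone with apex `x`. Then `P` is simple-homotopy equivalent to the suspension of the link of `0`.
Indeed, gluing to `P` the cone with apex `1` over the deletion of `0` gives a complex that collapses
both to `P` (along `x`) and to the suspension of the link (along `1`). -/
theorem eqvGen_suspension_link {P : Set (Finset ℕ)} (hP : IsLowerSet P) (hfin : P.Finite)
    (h1 : ∀ σ ∈ P, 1 ∉ σ) {x : ℕ} (hx0 : x ≠ 0) (hx1 : x ≠ 1)
    (hx : ∀ σ ∈ P, 0 ∉ σ → insert x σ ∈ P) :
    Relation.EqvGen ElementaryCollapse P
      (suspension {τ | insert 0 (τ.map (addRightEmbedding 2)) ∈ P}) := by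
  set X : Set (Finset ℕ) := {τ | insert 0 (τ.map (addRightEmbedding 2)) ∈ P} with hX
  have htail : ∀ σ : Finset ℕ, insert 0 ((tail σ).map (addRightEmbedding 2)) =
      insert 0 (σ.erase 1) := by
    intro σ
    refine eq_of_tail_eq ?_ (by simp) (by simp)
    ext i
    simp
  have hXlow : IsLowerSet X := fun σ τ hle hσ =>
    hP (Finset.insert_subset_insert 0 (Finset.map_subset_map.2 hle)) hσ
  have hmemX : ∀ σ, tail σ ∈ X ↔ insert 0 (σ.erase 1) ∈ P := fun σ => by
    rw [hX, Set.mem_ofPred_eq, htail]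
  set Γ : Set (Finset ℕ) := P ∪ {σ | σ.erase 1 ∈ P ∧ 0 ∉ σ} with hΓ
  have hΓlow : IsLowerSet Γ := by
    rintro σ τ hle (hσ | hσ)
    · exact Or.inl (hP hle hσ)
    · exact Or.inr ⟨hP (Finset.erase_subset_erase 1 hle) hσ.1, fun h => hσ.2 (hle h)⟩
  have hΓfin : Γ.Finite := by
    refine hfin.union (Set.Finite.subset (hfin.union (hfin.image (insert 1))) ?_)
    intro σ hσ
    by_cases h : 1 ∈ σ
    · exact Or.inr ⟨_, hσ.1, Finset.insert_erase h⟩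
    · exact Or.inl (by simpa [Finset.erase_eq_of_notMem h] using hσ.1)
  have hΓS : suspension X ⊆ Γ := by
    rintro σ ⟨hσ, h01⟩
    rw [hmemX] at hσ
    by_cases h0 : 0 ∈ σ
    · have h1σ : 1 ∉ σ := fun h => h01 ⟨h0, h⟩
      rw [Finset.erase_eq_of_notMem h1σ, Finset.insert_eq_of_mem h0] at hσ
      exact Or.inl hσ
    · exact Or.inr ⟨hP (Finset.subset_insert _ _) hσ, h0⟩
  have houtS : ∀ σ ∈ Γ, σ ∉ suspension X → σ.erase 1 ∈ P ∧ 0 ∉ σ := by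
    rintro σ (hσ | hσ) hσ'
    · have h1σ := h1 σ hσ
      rw [Finset.erase_eq_of_notMem h1σ]
      refine ⟨hσ, fun h0 => hσ' ⟨?_, fun h => h1σ h.2⟩⟩
      rw [hmemX, Finset.erase_eq_of_notMem h1σ, Finset.insert_eq_of_mem h0]
      exact hσ
    · exact hσ
  have hto : Relation.EqvGen ElementaryCollapse Γ P := by
    refine eqvGen_elementaryCollapse_of_matching hP x Γ hΓlow Set.subset_union_left
      (hΓfin.subset Set.sdiff_subset) ?_ ?_
    · rintro σ (hσ | hσ) hσ'
      · exact absurd hσ hσ'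
      · refine Or.inr ⟨?_, by simp [hσ.2, hx0.symm]⟩
        rw [Finset.erase_insert_of_ne hx1]
        exact hx _ hσ.1 (by simp [hσ.2])
    · rintro σ (hσ | hσ) hσ' h
      · exact hσ' hσ
      · refine hσ' ?_
        have h1σ : 1 ∉ σ := fun h1σ => h1 _ h (by simp [h1σ, hx1.symm])
        exact Finset.erase_eq_of_notMem h1σ ▸ hσ.1
  refine .trans _ _ _ (.symm _ _ hto) ?_
  refine eqvGen_elementaryCollapse_of_matching (isLowerSet_suspension hXlow) 1 Γ hΓlow hΓS
    (hΓfin.subset Set.sdiff_subset) ?_ ?_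
  · intro σ hσ hσ'
    have h := houtS σ hσ hσ'
    exact Or.inr ⟨by rw [Finset.erase_insert_eq_erase]; exact h.1, by simp [h.2]⟩
  · intro σ hσ hσ' h
    have h' := houtS σ hσ hσ'
    refine hσ' ⟨?_, fun h01 => h'.2 h01.1⟩
    have := h.1
    rwa [hmemX, Finset.erase_idem, ← hmemX] at this

/-- The boundary of the `(n + 1)`-dimensional cross-polytope is the suspension of the boundary of
the `n`-dimensional one. -/
theorem suspension_crossPolytopeBoundary {n : ℕ} {g : Fin n × Bool → ℕ}
    (hg : Function.Injective g) :
    ∃ g' : Fin (n + 1) × Bool → ℕ, Function.Injective g' ∧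
      suspension (Finset.image g '' (crossPolytopeBoundary n).faces) =
        Finset.image g' '' (crossPolytopeBoundary (n + 1)).faces := by
  set g' : Fin (n + 1) × Bool → ℕ := fun p =>
    Fin.cases (motive := fun _ => ℕ) (if p.2 then 1 else 0) (fun i => g (i, p.2) + 2) p.1 with hg'
  have hzero : ∀ b, g' (0, b) = if b then 1 else 0 := fun b => rfl
  have hsucc : ∀ i b, g' (Fin.succ i, b) = g (i, b) + 2 := fun i b => rfl
  have hinj : Function.Injective g' := by
    rintro ⟨i, b⟩ ⟨j, c⟩ h
    induction i using Fin.cases <;> induction j using Fin.cases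
    · revert h
      rw [hzero, hzero]
      cases b <;> cases c <;> simp
    · rw [hzero, hsucc] at h
      split_ifs at h
      all_goals omega
    · rw [hzero, hsucc] at h
      split_ifs at h
      all_goals omega
    · rw [hsucc, hsucc] at h
      have := hg (Nat.add_right_cancel h)
      simp only [Prod.mk.injEq] at this ⊢
      exact ⟨congrArg Fin.succ this.1, this.2⟩
  refine ⟨g', hinj, Set.Subset.antisymm ?_ ?_⟩
  · rintro σ ⟨⟨ρ, hρ, hρσ⟩, h01⟩
    have hmem : ∀ p, g p + 2 ∈ σ ↔ p ∈ ρ := fun p => by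
      rw [← mem_tail, ← hρσ, hg.mem_finset_image]
    refine ⟨Finset.univ.filter fun p => g' p ∈ σ, ?_, ?_⟩
    · intro i h
      simp only [Finset.mem_filter, Finset.mem_univ, true_and] at h
      induction i using Fin.cases with
      | zero => exact h01 (by simpa [hzero] using h)
      | succ i =>
        rw [hsucc, hsucc, hmem, hmem] at h
        exact hρ i h
    · ext k
      simp only [Finset.mem_image, Finset.mem_filter, Finset.mem_univ, true_and]
      refine ⟨fun ⟨p, hp, hk⟩ => hk ▸ hp, fun hk => ?_⟩
      suffices h : ∃ p, g' p = k by
        obtain ⟨p, rfl⟩ := h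
        exact ⟨p, hk, rfl⟩
      match k with
      | 0 => exact ⟨(0, false), rfl⟩
      | 1 => exact ⟨(0, true), rfl⟩
      | k + 2 =>
        rw [← mem_tail, ← hρσ, Finset.mem_image] at hk
        obtain ⟨p, -, hp⟩ := hk
        exact ⟨(p.1.succ, p.2), by rw [hsucc]; simp [hp]⟩
  · rintro _ ⟨ρ, hρ, rfl⟩
    refine ⟨⟨Finset.univ.filter fun p => (p.1.succ, p.2) ∈ ρ, ?_, ?_⟩, ?_⟩
    · intro i h
      simp only [Finset.mem_filter, Finset.mem_univ, true_and] at h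
      exact hρ _ h
    · ext k
      simp only [mem_tail, Finset.mem_image, Finset.mem_filter, Finset.mem_univ, true_and]
      constructor
      · rintro ⟨p, hp, rfl⟩
        exact ⟨_, hp, hsucc _ _⟩
      · rintro ⟨⟨i, b⟩, hp, hk⟩
        induction i using Fin.cases with
        | zero =>
          rw [hzero] at hk
          split_ifs at hk
          all_goals omega
        | succ i => exact ⟨(i, b), hp, Nat.add_right_cancel hk⟩
    · intro h
      exact hρ 0 ⟨hinj.mem_finset_image.1 h.1, hinj.mem_finset_image.1 h.2⟩

/-! ### Homotopy types of families of faces -/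

/-- After some relabelling by natural numbers, the family `F` is simple-homotopy equivalent to the
void complex. Relabellings are injective on the whole type, so that ground sets play no role. -/
def HasVoidType (F : Set (Finset α)) : Prop :=
  ∃ f : α → ℕ, Function.Injective f ∧ Relation.EqvGen ElementaryCollapse (Finset.image f '' F) ∅

/-- After some relabelling by natural numbers, the family `F` is simple-homotopy equivalent to the
boundary of the `n`-dimensional cross-polytope. Relabellings are injective on the whole type, so
that ground sets play no role. -/
def HasSphereType (F : Set (Finset α)) (n : ℕ) : Prop :=
  ∃ f : α → ℕ, Function.Injective f ∧ ∃ g : Fin n × Bool → ℕ, Function.Injective g ∧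
    Relation.EqvGen ElementaryCollapse (Finset.image f '' F)
      (Finset.image g '' (crossPolytopeBoundary n).faces)

theorem HasVoidType.simpleHomotopyEquiv {β : Type*} {K : GroundedComplex α}
    (h : HasVoidType K.faces) : K.SimpleHomotopyEquiv (void β) := by
  obtain ⟨f, hf, h⟩ := h
  exact ⟨f, fun _ => 0, hf.injOn, by simp [void], by simpa [void] using h⟩

theorem HasSphereType.simpleHomotopyEquiv {K : GroundedComplex α} {n : ℕ}
    (h : HasSphereType K.faces n) : K.SimpleHomotopyEquiv (crossPolytopeBoundary n) := by
  obtain ⟨f, hf, g, hg, h⟩ := h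
  exact ⟨f, g, hf.injOn, hg.injOn, h⟩

theorem hasVoidType_empty [Countable α] : HasVoidType (∅ : Set (Finset α)) := by
  obtain ⟨f, hf⟩ := Countable.exists_injective_nat α
  exact ⟨f, hf, by rw [Set.image_empty]; exact .refl _⟩

theorem hasSphereType_singleton_empty [Countable α] : HasSphereType ({∅} : Set (Finset α)) 0 := by
  obtain ⟨f, hf⟩ := Countable.exists_injective_nat α
  refine ⟨f, hf, fun _ => 0, fun p => p.1.elim0, ?_⟩
  have : (crossPolytopeBoundary 0).faces = {∅} := by
    ext σ
    simp [crossPolytopeBoundary, Finset.eq_empty_of_isEmpty]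
  rw [this, Set.image_singleton, Set.image_singleton, Finset.image_empty, Finset.image_empty]
  exact .refl _

theorem finite_faces (K : GroundedComplex α) : K.faces.Finite :=
  (Finset.finite_toSet K.ground.powerset).subset fun σ hσ =>
    Finset.mem_coe.2 (Finset.mem_powerset.2 (K.subset_ground σ hσ))

theorem isLowerSet_image_faces (K : GroundedComplex α) (f : α → ℕ) :
    IsLowerSet (Finset.image f '' K.faces) := by
  classical
  rintro _ τ hle ⟨ρ, hρ, rfl⟩
  obtain ⟨κ, hκ, rfl⟩ := Finset.subset_image_iff.1 hle
  exact ⟨κ, K.down_closed ρ hρ κ (by simpa using hκ), rfl⟩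

variable [DecidableEq α]

/-- A cone collapses to the void complex. -/
theorem hasVoidType_of_insert_mem [Countable α] (K : GroundedComplex α) (x : α)
    (hx : ∀ σ ∈ K.faces, insert x σ ∈ K.faces) : HasVoidType K.faces := by
  obtain ⟨f, hf⟩ := Countable.exists_injective_nat α
  refine ⟨f, hf, eqvGen_elementaryCollapse_of_matching isLowerSet_empty (f x) _
    (isLowerSet_image_faces K f) (Set.empty_subset _)
    ((K.finite_faces.image _).subset Set.sdiff_subset) ?_ (fun _ _ _ h => h)⟩
  rintro _ ⟨σ, hσ, rfl⟩ -
  exact ⟨insert x σ, hx σ hσ, Finset.image_insert _ _ _⟩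

/-- If the deletion of `a` is a cone, then the complex is simple-homotopy equivalent to the
suspension of the link of `a`. -/
theorem exists_eqvGen_suspension_link (K : GroundedComplex α) {a x : α} (hxa : x ≠ a)
    (hx : ∀ σ ∈ K.faces, a ∉ σ → insert x σ ∈ K.faces) {f : α → ℕ} (hf : Function.Injective f) :
    ∃ f' : α → ℕ, Function.Injective f' ∧ Relation.EqvGen ElementaryCollapse
      (Finset.image f' '' K.faces) (suspension (Finset.image f '' (K.link a).faces)) := by
  set f' : α → ℕ := fun y => if y = a then 0 else f y + 2 with hf'
  have ha : f' a = 0 := if_pos rfl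
  have hne : ∀ y, y ≠ a → f' y = f y + 2 := fun y hy => if_neg hy
  have hinj : Function.Injective f' := by
    intro y z h
    by_cases hy : y = a <;> by_cases hz : z = a
    · rw [hy, hz]
    · rw [hy, ha, hne z hz] at h
      omega
    · rw [hz, ha, hne y hy] at h
      omega
    · rw [hne y hy, hne z hz] at h
      exact hf (Nat.add_right_cancel h)
  have h0 : ∀ σ : Finset α, 0 ∈ σ.image f' ↔ a ∈ σ := fun σ => by
    rw [← ha, hinj.mem_finset_image]
  have hshift : ∀ σ : Finset α, a ∉ σ →
      (σ.image f).map (addRightEmbedding 2) = σ.image f' := by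
    intro σ hσ
    rw [Finset.map_eq_image, Finset.image_image]
    refine Finset.image_congr fun y hy => ?_
    rw [hne y (fun h => hσ (h ▸ hy))]
    rfl
  have hlink : {τ : Finset ℕ | insert 0 (τ.map (addRightEmbedding 2)) ∈
      Finset.image f' '' K.faces} = Finset.image f '' (K.link a).faces := by
    ext τ
    constructor
    · rintro ⟨κ, hκ, h⟩
      have haκ : a ∈ κ := by
        rw [← h0, h]
        exact Finset.mem_insert_self _ _
      refine ⟨κ.erase a, ⟨by simp, by rwa [Finset.insert_erase haκ]⟩, ?_⟩
      refine Finset.map_injective (addRightEmbedding 2) ?_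
      rw [hshift _ (by simp), Finset.image_erase hinj, ha, h, Finset.erase_insert (by simp)]
    · rintro ⟨ρ, ⟨haρ, hρ⟩, rfl⟩
      exact ⟨_, hρ, by rw [Finset.image_insert, ha, hshift ρ haρ]⟩
  refine ⟨f', hinj, ?_⟩
  rw [← hlink]
  refine eqvGen_suspension_link (isLowerSet_image_faces K f') (K.finite_faces.image _) ?_
    (x := f' x) ?_ ?_ ?_
  · rintro _ ⟨σ, -, rfl⟩ h
    obtain ⟨y, -, hy⟩ := Finset.mem_image.1 h
    by_cases hya : y = a
    · rw [hya, ha] at hy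
      omega
    · rw [hne y hya] at hy
      omega
  · rw [hne x hxa]
    omega
  · rw [hne x hxa]
    omega
  · rintro _ ⟨σ, hσ, rfl⟩ h
    rw [h0] at h
    exact ⟨_, hx σ hσ h, Finset.image_insert _ _ _⟩

theorem HasVoidType.of_link {K : GroundedComplex α} {a x : α} (hxa : x ≠ a)
    (hx : ∀ σ ∈ K.faces, a ∉ σ → insert x σ ∈ K.faces) (h : HasVoidType (K.link a).faces) :
    HasVoidType K.faces := by
  obtain ⟨f, hf, h⟩ := h
  obtain ⟨f', hf', h'⟩ := K.exists_eqvGen_suspension_link hxa hx hf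
  have := eqvGen_suspension h
  rw [suspension_empty] at this
  exact ⟨f', hf', .trans _ _ _ h' this⟩

theorem HasSphereType.of_link {K : GroundedComplex α} {a x : α} (hxa : x ≠ a)
    (hx : ∀ σ ∈ K.faces, a ∉ σ → insert x σ ∈ K.faces) {n : ℕ}
    (h : HasSphereType (K.link a).faces n) : HasSphereType K.faces (n + 1) := by
  obtain ⟨f, hf, g, hg, h⟩ := h
  obtain ⟨f', hf', h'⟩ := K.exists_eqvGen_suspension_link hxa hx hf
  obtain ⟨g', hg', h''⟩ := suspension_crossPolytopeBoundary hg
  exact ⟨f', hf', g', hg', .trans _ _ _ h' (h'' ▸ eqvGen_suspension h)⟩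

/-! ### Covering complexes -/

omit [DecidableEq α] in
theorem eq_of_ground_eq_of_faces_iff {K L : GroundedComplex α} (hg : K.ground = L.ground)
    (hf : ∀ σ, σ ∈ K.faces ↔ σ ∈ L.faces) : K = L := by
  cases K
  cases L
  obtain rfl := hg
  obtain rfl := Set.ext hf
  rfl

/-- The covering complex of a relation `R`: the faces are the subsets `F` of `A` such that every
`c ∈ C` is related to some element of `A` outside `F`. Equivalently, no set `{a ∈ A | R a c}` with
`c ∈ C` is contained in a face. -/
def coveringComplex (R : α → γ → Prop) (A : Finset α) (C : Finset γ) : GroundedComplex α where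
  ground := A
  faces := {F | F ⊆ A ∧ ∀ c ∈ C, ∃ a ∈ A, a ∉ F ∧ R a c}
  subset_ground := fun _ hF => hF.1
  down_closed := fun _ hF _ hF' => ⟨hF'.trans hF.1, fun c hc =>
    let ⟨a, ha, h⟩ := hF.2 c hc
    ⟨a, ha, fun h' => h.1 (hF' h'), h.2⟩⟩

variable {R : α → γ → Prop} {A : Finset α} {C : Finset γ}

theorem link_coveringComplex {a : α} (ha : a ∈ A) :
    (coveringComplex R A C).link a = coveringComplex R (A.erase a) C := by
  refine eq_of_ground_eq_of_faces_iff rfl fun σ => ⟨?_, ?_⟩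
  · rintro ⟨haσ, hsub, h⟩
    refine ⟨Finset.subset_erase.2 ⟨(Finset.subset_insert _ _).trans hsub, haσ⟩, fun c hc => ?_⟩
    obtain ⟨b, hb, hbσ, hR⟩ := h c hc
    rw [Finset.mem_insert, not_or] at hbσ
    exact ⟨b, Finset.mem_erase.2 ⟨hbσ.1, hb⟩, hbσ.2, hR⟩
  · rintro ⟨hsub, h⟩
    rw [Finset.subset_erase] at hsub
    refine ⟨hsub.2, Finset.insert_subset ha hsub.1, fun c hc => ?_⟩
    obtain ⟨b, hb, hbσ, hR⟩ := h c hc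
    rw [Finset.mem_erase] at hb
    exact ⟨b, hb.2, by simp [hb.1, hbσ], hR⟩

open Classical in
theorem deletion_coveringComplex {a : α} (ha : a ∈ A) :
    (coveringComplex R A C).deletion a =
      coveringComplex R (A.erase a) (C.filter fun c => ¬ R a c) := by
  refine eq_of_ground_eq_of_faces_iff rfl fun σ => ⟨?_, ?_⟩
  · rintro ⟨⟨hsub, h⟩, haσ⟩
    refine ⟨Finset.subset_erase.2 ⟨hsub, haσ⟩, fun c hc => ?_⟩
    rw [Finset.mem_filter] at hc
    obtain ⟨b, hb, hbσ, hR⟩ := h c hc.1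
    exact ⟨b, Finset.mem_erase.2 ⟨fun h => hc.2 (h ▸ hR), hb⟩, hbσ, hR⟩
  · rintro ⟨hsub, h⟩
    rw [Finset.subset_erase] at hsub
    refine ⟨⟨hsub.1, fun c hc => ?_⟩, hsub.2⟩
    by_cases hac : R a c
    · exact ⟨a, ha, hsub.2, hac⟩
    · obtain ⟨b, hb, hbσ, hR⟩ := h c (Finset.mem_filter.2 ⟨hc, hac⟩)
      exact ⟨b, Finset.mem_of_mem_erase hb, hbσ, hR⟩

/-- If every constraint met by `v` is also met by `a ≠ v`, then the deletion of `a` is a cone with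
apex `v`. -/
theorem insert_mem_coveringComplex {a v : α} (ha : a ∈ A) (hv : v ∈ A) (hav : a ≠ v)
    (h : ∀ c ∈ C, R v c → R a c) (σ : Finset α) (hσ : σ ∈ (coveringComplex R A C).faces)
    (haσ : a ∉ σ) : insert v σ ∈ (coveringComplex R A C).faces := by
  refine ⟨Finset.insert_subset hv hσ.1, fun c hc => ?_⟩
  obtain ⟨b, hb, hbσ, hR⟩ := hσ.2 c hc
  by_cases hbv : b = v
  · exact ⟨a, ha, by simp [hav, haσ], h c hc (hbv ▸ hR)⟩
  · exact ⟨b, hb, by simp [hbv, hbσ], hR⟩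

theorem hasVoidType_coveringComplex_of_apex [Countable α] {v : α} (hv : v ∈ A)
    (h : ∀ c ∈ C, ¬ R v c) : HasVoidType (coveringComplex R A C).faces := by
  refine hasVoidType_of_insert_mem _ v fun σ hσ => ⟨Finset.insert_subset hv hσ.1, fun c hc => ?_⟩
  obtain ⟨b, hb, hbσ, hR⟩ := hσ.2 c hc
  exact ⟨b, hb, by simp [hbσ, show b ≠ v from fun hbv => h c hc (hbv ▸ hR)], hR⟩

omit [DecidableEq α] in
theorem hasVoidType_coveringComplex_of_uncovered [Countable α] {c : γ} (hc : c ∈ C)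
    (h : ∀ a ∈ A, ¬ R a c) : HasVoidType (coveringComplex R A C).faces := by
  have : (coveringComplex R A C).faces = ∅ := by
    refine Set.eq_empty_of_forall_notMem fun σ hσ => ?_
    obtain ⟨a, ha, -, hR⟩ := hσ.2 c hc
    exact h a ha hR
  rw [this]
  exact hasVoidType_empty

omit [DecidableEq α] in
theorem hasSphereType_coveringComplex_empty [Countable α] :
    HasSphereType (coveringComplex R (∅ : Finset α) ∅).faces 0 := by
  have : (coveringComplex R (∅ : Finset α) ∅).faces = {∅} := by
    ext σ
    simp [coveringComplex]
  rw [this]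
  exact hasSphereType_singleton_empty

theorem HasVoidType.of_sdiff (Q : Finset α) (hQ : Q ⊆ A)
    (h : ∀ a ∈ Q, ∃ v ∈ A \ Q, ∀ c ∈ C, R v c → R a c)
    (hV : HasVoidType (coveringComplex R (A \ Q) C).faces) :
    HasVoidType (coveringComplex R A C).faces := by
  induction Q using Finset.induction_on generalizing A with
  | empty => simpa using hV
  | insert a Q ha ih =>
    obtain ⟨haA, hQA⟩ := Finset.insert_subset_iff.1 hQ
    obtain ⟨v, hv, hva⟩ := h a (Finset.mem_insert_self a Q)
    have hv' : v ∈ A ∧ v ≠ a := by simp at hv; tauto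
    refine HasVoidType.of_link hv'.2 (insert_mem_coveringComplex haA hv'.1 hv'.2.symm hva) ?_
    rw [link_coveringComplex haA]
    have hsd : A.erase a \ Q = A \ insert a Q := by
      rw [Finset.sdiff_insert, Finset.erase_sdiff_comm]
    refine ih (Finset.subset_erase.2 ⟨hQA, ha⟩) (fun b hb => ?_) (by rwa [hsd])
    rw [hsd]
    exact h b (Finset.mem_insert_of_mem hb)

/-- If each element of `Q` meets all constraints met by some element of `A` outside `Q`, then
restricting the covering complex to `A \ Q` is an iterated desuspension. -/
theorem HasSphereType.of_sdiff (Q : Finset α) (hQ : Q ⊆ A)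
    (h : ∀ a ∈ Q, ∃ v ∈ A \ Q, ∀ c ∈ C, R v c → R a c) {n : ℕ}
    (hS : HasSphereType (coveringComplex R (A \ Q) C).faces n) :
    HasSphereType (coveringComplex R A C).faces (n + Q.card) := by
  induction Q using Finset.induction_on generalizing A with
  | empty => simpa using hS
  | insert a Q ha ih =>
    obtain ⟨haA, hQA⟩ := Finset.insert_subset_iff.1 hQ
    obtain ⟨v, hv, hva⟩ := h a (Finset.mem_insert_self a Q)
    have hv' : v ∈ A ∧ v ≠ a := by simp at hv; tauto
    rw [Finset.card_insert_of_notMem ha, ← add_assoc]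
    refine HasSphereType.of_link hv'.2 (insert_mem_coveringComplex haA hv'.1 hv'.2.symm hva) ?_
    rw [link_coveringComplex haA]
    have hsd : A.erase a \ Q = A \ insert a Q := by
      rw [Finset.sdiff_insert, Finset.erase_sdiff_comm]
    refine ih (Finset.subset_erase.2 ⟨hQA, ha⟩) (fun b hb => ?_) (by rwa [hsd])
    rw [hsd]
    exact h b (Finset.mem_insert_of_mem hb)

/-! ### Covering complexes that are strong combinatorial grapes -/

theorem isCone_of_insert_mem {K : GroundedComplex α} {x : α} (hx : x ∈ K.ground)
    (h : ∀ σ ∈ K.faces, insert x σ ∈ K.faces) : K.IsCone := by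
  refine ⟨x, hx, K.deletion x, fun σ hσ => hσ.2, Set.Subset.antisymm (fun σ hσ => ?_) ?_⟩
  · refine ⟨σ.erase x, ⟨K.down_closed σ hσ _ (Finset.erase_subset _ _), by simp⟩, ?_⟩
    by_cases hxσ : x ∈ σ
    · exact ⟨{x}, by simp, by rw [Finset.union_comm, ← Finset.insert_eq, Finset.insert_erase hxσ]⟩
    · exact ⟨∅, by simp, by simp [hxσ]⟩
  · rintro _ ⟨σ, hσ, τ, hτ, rfl⟩
    rcases hτ with rfl | hτ
    · simpa using hσ.1
    · rw [Set.mem_singleton_iff.1 hτ, Finset.union_comm, ← Finset.insert_eq]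
      exact h σ hσ.1

/-- A sufficient condition, inherited by links and deletions, for covering complexes to be strong
combinatorial grapes: as long as there are at least two elements in `A`, either some `a` meets all
constraints met by some `v ≠ a`, so that the deletion of `a` is a cone with apex `v`, or `a` is the
only element that meets some constraint, so that the link of `a` is void. -/
theorem isStrongCombinatorialGrape_coveringComplex (A₀ : Finset α) (C₀ : Finset γ)
    (h : ∀ A ⊆ A₀, ∀ C ⊆ C₀, 1 < A.card →
      (∃ v ∈ A, ∃ a ∈ A, a ≠ v ∧ ∀ c ∈ C, R v c → R a c) ∨
      ∃ c ∈ C, ∃ a ∈ A, ∀ b ∈ A, R b c → b = a) :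
    (coveringComplex R A₀ C₀).IsStrongCombinatorialGrape := by
  suffices hmain : ∀ n, ∀ A ⊆ A₀, ∀ C ⊆ C₀, A.card = n →
      (coveringComplex R A C).IsStrongCombinatorialGrape from
    hmain _ A₀ subset_rfl C₀ subset_rfl rfl
  intro n
  induction n with
  | zero =>
    intro A _ C _ hA
    refine .of_atMostOneVertex _ fun x y hx _ => ?_
    have := hx.1 (Finset.mem_singleton_self x)
    simp [Finset.card_eq_zero.1 hA] at this
  | succ n ih =>
    intro A hA C hC hcard
    classical
    have hstep : ∀ a ∈ A,
        ((coveringComplex R A C).link a).IsCone ∨ ((coveringComplex R A C).deletion a).IsCone →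
        (coveringComplex R A C).IsStrongCombinatorialGrape := by
      intro a ha hcone
      have hA' : A.erase a ⊆ A₀ := (Finset.erase_subset _ _).trans hA
      have hcard' : (A.erase a).card = n := by rw [Finset.card_erase_of_mem ha]; omega
      refine .of_link_deletion _ a ha hcone ?_ ?_
      · rw [deletion_coveringComplex ha]
        exact ih _ hA' _ ((Finset.filter_subset _ _).trans hC) hcard'
      · rw [link_coveringComplex ha]
        exact ih _ hA' _ hC hcard'
    by_cases hn : n = 0
    · refine .of_atMostOneVertex _ fun x y hx hy => ?_
      exact Finset.card_le_one.1 (by omega : A.card ≤ 1) x (hx.1 (by simp)) y (hy.1 (by simp))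
    · rcases h A hA C hC (by omega) with ⟨v, hv, a, ha, hav, hR⟩ | ⟨c, hc, a, ha, hR⟩
      · refine hstep a ha (Or.inr (isCone_of_insert_mem (x := v) ?_ ?_))
        · exact Finset.mem_erase.2 ⟨hav.symm, hv⟩
        · exact fun σ hσ => ⟨insert_mem_coveringComplex ha hv hav hR σ hσ.1 hσ.2,
            by simp [hav, hσ.2]⟩
      · obtain ⟨b, hb⟩ : (A.erase a).Nonempty := by
          rw [← Finset.card_pos, Finset.card_erase_of_mem ha]
          omega
        refine hstep a ha (Or.inl (isCone_of_insert_mem (x := b) hb fun σ hσ => ?_))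
        rw [link_coveringComplex ha] at hσ
        obtain ⟨d, hd, -, hdc⟩ := hσ.2 c hc
        exact absurd (hR d (Finset.mem_of_mem_erase hd) hdc) (Finset.ne_of_mem_erase hd)

end GroundedComplex

namespace SimpleGraph

open GroundedComplex

variable {V : Type*} {G : SimpleGraph V}

/-! ### Leaves of forests -/

/-- An endpoint of a longest path in the subgraph induced on `S` has at most one neighbour in
`S`. -/
theorem IsAcyclic.exists_leaf (hG : G.IsAcyclic) {S : Finset V} (hS : S.Nonempty) :
    ∃ v ∈ S, ∃ w, ∀ u ∈ S, G.Adj v u → u = w := by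
  classical
  have : Nonempty (S : Set V) := hS.to_subtype
  obtain ⟨u, v, p, hp, hmax⟩ :=
    Walk.exists_isPath_forall_isPath_length_le_length (G.induce (S : Set V))
  refine ⟨u, u.2, p.snd, fun x hx hadj => ?_⟩
  have hadj' : (G.induce (S : Set V)).Adj u ⟨x, hx⟩ := hadj
  by_cases hsupp : ⟨x, hx⟩ ∈ p.support
  · exact congrArg Subtype.val ((hG.induce (S : Set V)).eq_snd_of_adj_start hp hadj' hsupp)
  · have := hmax _ _ (Walk.cons hadj'.symm p) (hp.cons hsupp)
    simp at this

theorem IsAcyclic.exists_leaf_of_edges (hG : G.IsAcyclic) {T : Finset (Sym2 V)}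
    (hT : ∀ e ∈ T, e ∈ G.edgeSet) {S : Finset V} (hS : S.Nonempty) :
    ∃ v ∈ S, ∃ w, ∀ u ∈ S, s(v, u) ∈ T → u = w := by
  have hle : fromEdgeSet (T : Set (Sym2 V)) ≤ G := fun x y h =>
    hT _ ((fromEdgeSet_adj _).1 h).1
  obtain ⟨v, hv, w, hw⟩ := (hG.anti hle).exists_leaf hS
  refine ⟨v, hv, w, fun u hu h => hw u hu ?_⟩
  exact (fromEdgeSet_adj _).2 ⟨h, Adj.ne (G := G) (hT _ h)⟩

/-- Every nonempty set `T` of edges of a forest has an edge `xy`, with `x` a leaf, such that at most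
one neighbour `z` of `y` is not a leaf: `y` is a leaf after all leaves have been removed. -/
theorem IsAcyclic.exists_penultimate [Fintype V] (hG : G.IsAcyclic) {T : Finset (Sym2 V)}
    (hT : ∀ e ∈ T, e ∈ G.edgeSet) (hne : T.Nonempty) :
    ∃ x y z, s(x, y) ∈ T ∧ (∀ e ∈ T, x ∈ e → e = s(x, y)) ∧
      ∀ u, s(u, y) ∈ T → u ≠ z → ∀ e ∈ T, u ∈ e → e = s(u, y) := by
  classical
  set W : Finset V := Finset.univ.filter fun x => ∃ e ∈ T, ∃ e' ∈ T, e ≠ e' ∧ x ∈ e ∧ x ∈ e'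
    with hW
  have hleaf : ∀ u, u ∉ W → ∀ y, s(u, y) ∈ T → ∀ e ∈ T, u ∈ e → e = s(u, y) := by
    intro u hu y hy e he hue
    by_contra hne
    exact hu (by simpa [hW] using ⟨e, he, s(u, y), hy, hne, hue, by simp⟩)
  rcases W.eq_empty_or_nonempty with hWe | hWne
  · obtain ⟨e, he⟩ := hne
    induction e using Sym2.ind with
    | _ x y =>
      exact ⟨x, y, x, he, hleaf x (by simp [hWe]) y he,
        fun u hu _ => hleaf u (by simp [hWe]) y hu⟩
  · obtain ⟨y, hy, z, hz⟩ := hG.exists_leaf_of_edges hT hWne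
    have hout : ∀ u, s(u, y) ∈ T → u ≠ z → u ∉ W := fun u hu huz huW =>
      huz (hz u huW (by rwa [Sym2.eq_swap]))
    obtain ⟨e, he, e', he', hee, hye, hye'⟩ := (Finset.mem_filter.1 hy).2
    obtain ⟨x, hx, hxz⟩ : ∃ x, s(x, y) ∈ T ∧ x ≠ z := by
      obtain ⟨u, rfl⟩ := hye
      obtain ⟨u', rfl⟩ := hye'
      by_cases huz : u = z
      · exact ⟨u', by rwa [Sym2.eq_swap], fun h => hee (by rw [huz, h])⟩
      · exact ⟨u, by rwa [Sym2.eq_swap], huz⟩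
    exact ⟨x, y, z, hx, hleaf x (hout x hx hxz) y hx,
      fun u hu huz => hleaf u (hout u hu huz) y hu⟩

/-! ### The four complexes as covering complexes -/

/-- The closed neighbourhood relation of vertices. -/
def DominatesVertex (G : SimpleGraph V) (d v : V) : Prop := d = v ∨ G.Adj d v

/-- The relation of having a common endpoint. -/
def EdgesMeet (e' e : Sym2 V) : Prop := ∃ v, v ∈ e' ∧ v ∈ e

section Fintype

variable [Fintype V]

theorem dominanceComplex_eq [DecidableEq V] :
    G.dominanceComplex = coveringComplex G.DominatesVertex Finset.univ Finset.univ := by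
  refine eq_of_ground_eq_of_faces_iff rfl fun σ => ?_
  simp [dominanceComplex, coveringComplex, IsDominatingSet, DominatesVertex]

variable [DecidableEq V] [DecidableRel G.Adj]

theorem independenceComplex_eq :
    G.independenceComplex =
      coveringComplex (fun (v : V) (e : Sym2 V) => v ∈ e) Finset.univ G.edgeFinset := by
  refine eq_of_ground_eq_of_faces_iff rfl fun σ => ?_
  simp only [independenceComplex, coveringComplex, Set.mem_ofPred_eq, Finset.subset_univ, true_and,
    Finset.mem_univ, mem_edgeFinset]
  constructor
  · intro h e he
    induction e using Sym2.ind with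
    | _ x y =>
      by_contra! hσ
      exact h (by simpa using fun hx => hσ x hx (by simp))
        (by simpa using fun hy => hσ y hy (by simp)) (Adj.ne he) he
  · intro h x hx y hy _ hadj
    obtain ⟨a, haσ, ha⟩ := h s(x, y) hadj
    rcases Sym2.mem_iff.1 ha with rfl | rfl
    · exact haσ hx
    · exact haσ hy

theorem edgeCoveringComplex_eq :
    G.edgeCoveringComplex =
      coveringComplex (fun (e : Sym2 V) (v : V) => v ∈ e) G.edgeFinset Finset.univ := by
  refine eq_of_ground_eq_of_faces_iff rfl fun σ => ?_
  simp [edgeCoveringComplex, coveringComplex, and_assoc]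

theorem edgeDominanceComplex_eq :
    G.edgeDominanceComplex = coveringComplex EdgesMeet G.edgeFinset G.edgeFinset := by
  refine eq_of_ground_eq_of_faces_iff rfl fun σ => ?_
  simp [edgeDominanceComplex, coveringComplex, EdgesMeet, and_assoc]

/-! ### The four complexes of a forest are strong combinatorial grapes -/

/-- If `v` is a leaf with neighbour `w`, then `w` meets every edge that `v` meets. -/
theorem isStrongCombinatorialGrape_independenceComplex (hG : G.IsAcyclic) :
    G.independenceComplex.IsStrongCombinatorialGrape := by
  rw [independenceComplex_eq]
  refine isStrongCombinatorialGrape_coveringComplex _ _ fun A _ C hC hA => ?_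
  obtain ⟨v, hv, w, hw⟩ := hG.exists_leaf_of_edges (T := C)
    (fun e he => mem_edgeFinset.1 (hC he)) (S := A) (Finset.card_pos.1 (by omega))
  by_cases hex : ∃ u, u ∉ A ∧ s(v, u) ∈ C
  · obtain ⟨u, hu, huC⟩ := hex
    refine Or.inr ⟨_, huC, v, hv, fun b hb hbe => ?_⟩
    rcases Sym2.mem_iff.1 hbe with rfl | rfl
    · rfl
    · exact absurd hb hu
  push Not at hex
  have hall : ∀ c ∈ C, v ∈ c → c = s(v, w) := by
    rintro c hc ⟨u, rfl⟩
    by_cases hu : u ∈ A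
    · rw [hw u hu hc]
    · exact absurd hc (hex u hu)
  by_cases hwA : w ∈ A ∧ w ≠ v
  · exact Or.inl ⟨v, hv, w, hwA.1, hwA.2, fun c hc hvc => by simp [hall c hc hvc]⟩
  · obtain ⟨a, ha, hav⟩ := Finset.exists_mem_ne hA v
    refine Or.inl ⟨v, hv, a, ha, hav, fun c hc hvc => ?_⟩
    have hvw := hall c hc hvc
    rw [hvw] at hc
    refine absurd ⟨?_, (Adj.ne (G := G) (mem_edgeFinset.1 (hC hc))).symm⟩ hwA
    by_contra hwA'
    exact hex w hwA' hc

omit [DecidableRel G.Adj] in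
/-- If `v` is a leaf with neighbour `w` in the subgraph induced on `A ∪ C`, then `w` dominates every
vertex that `v` dominates. The other cases treat `v` or `w` missing from `A` or `C`. -/
theorem isStrongCombinatorialGrape_dominanceComplex (hG : G.IsAcyclic) :
    G.dominanceComplex.IsStrongCombinatorialGrape := by
  rw [dominanceComplex_eq]
  refine isStrongCombinatorialGrape_coveringComplex _ _ fun A _ C _ hA => ?_
  obtain ⟨a₀, ha₀⟩ := Finset.card_pos.1 (show 0 < A.card by omega)
  obtain ⟨v, hv, w, hw⟩ := hG.exists_leaf (S := A ∪ C) ⟨a₀, by simp [ha₀]⟩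
  simp only [Finset.mem_union] at hv hw
  by_cases hvA : v ∈ A
  · by_cases hvC : v ∈ C
    · by_cases hwA : w ∈ A ∧ G.Adj w v
      · refine Or.inl ⟨v, hvA, w, hwA.1, hwA.2.ne, fun c hc hvc => ?_⟩
        rcases hvc with rfl | hvc
        · exact Or.inr hwA.2
        · exact Or.inl (hw c (Or.inr hc) hvc).symm
      · refine Or.inr ⟨v, hvC, v, hvA, fun b hb hbv => ?_⟩
        rcases hbv with rfl | hbv
        · rfl
        · exact absurd ⟨hw b (Or.inl hb) hbv.symm ▸ hb, hw b (Or.inl hb) hbv.symm ▸ hbv⟩ hwA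
    · -- only the constraint at `w` can contain `v`
      have hall : ∀ c ∈ C, G.DominatesVertex v c → c = w := by
        rintro c hc (rfl | hvc)
        · exact absurd hc hvC
        · exact hw c (Or.inr hc) hvc
      by_cases hex : ∃ a ∈ A, a ≠ v ∧ ∀ c ∈ C, G.DominatesVertex v c → G.DominatesVertex a c
      · obtain ⟨a, ha, hav, h⟩ := hex
        exact Or.inl ⟨v, hvA, a, ha, hav, h⟩
      · push Not at hex
        obtain ⟨b, hb, hbv⟩ := Finset.exists_mem_ne hA v
        obtain ⟨c, hc, hvc, -⟩ := hex b hb hbv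
        refine Or.inr ⟨c, hc, v, hvA, fun a ha hac => ?_⟩
        by_contra hav
        obtain ⟨c', hc', hvc', hac'⟩ := hex a ha hav
        rw [hall c' hc' hvc', ← hall c hc hvc] at hac'
        exact hac' hac
  · have hvC : v ∈ C := hv.resolve_left hvA
    have hall : ∀ b ∈ A, G.DominatesVertex b v → b = w := by
      rintro b hb (rfl | hbv)
      · exact absurd hb hvA
      · exact hw b (Or.inl hb) hbv.symm
    by_cases hwA : w ∈ A
    · exact Or.inr ⟨v, hvC, w, hwA, hall⟩
    · exact Or.inr ⟨v, hvC, a₀, ha₀, fun b hb hbv => absurd (hall b hb hbv ▸ hb) hwA⟩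

/-- If `x` is a leaf with neighbour `y`, and `x` is not a constraint, then any other edge at `y` meets
the only constraint `y` that the edge `xy` can meet. -/
theorem isStrongCombinatorialGrape_edgeCoveringComplex (hG : G.IsAcyclic) :
    G.edgeCoveringComplex.IsStrongCombinatorialGrape := by
  rw [edgeCoveringComplex_eq]
  refine isStrongCombinatorialGrape_coveringComplex _ _ fun A hA₀ C _ hA => ?_
  have hAe : ∀ e ∈ A, e ∈ G.edgeSet := fun e he => mem_edgeFinset.1 (hA₀ he)
  obtain ⟨x, y, -, hxy, hx, -⟩ := hG.exists_penultimate hAe (Finset.card_pos.1 (by omega))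
  by_cases hxC : x ∈ C
  · exact Or.inr ⟨x, hxC, _, hxy, hx⟩
  by_cases hex : ∃ a ∈ A, a ≠ s(x, y) ∧ y ∈ a
  · obtain ⟨a, ha, hav, hya⟩ := hex
    refine Or.inl ⟨_, hxy, a, ha, hav, fun c hc hcv => ?_⟩
    rcases Sym2.mem_iff.1 hcv with rfl | rfl
    · exact absurd hc hxC
    · exact hya
  push Not at hex
  by_cases hyC : y ∈ C
  · exact Or.inr ⟨y, hyC, _, hxy, fun b hb hyb => by_contra fun hne => hex b hb hne hyb⟩
  · obtain ⟨a, ha, hav⟩ := Finset.exists_mem_ne hA s(x, y)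
    refine Or.inl ⟨_, hxy, a, ha, hav, fun c hc hcv => ?_⟩
    rcases Sym2.mem_iff.1 hcv with rfl | rfl
    · exact absurd hc hxC
    · exact absurd hc hyC

/-- Any edge at `y` meets all edges that a pendant edge at `y` meets. The remaining cases, with few
edges of `A` at `y`, use that all but one of the neighbours of `y` are leaves. -/
theorem isStrongCombinatorialGrape_edgeDominanceComplex (hG : G.IsAcyclic) :
    G.edgeDominanceComplex.IsStrongCombinatorialGrape := by
  rw [edgeDominanceComplex_eq]
  refine isStrongCombinatorialGrape_coveringComplex _ _ fun A hA₀ C hC₀ hA => ?_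
  obtain ⟨a₀, ha₀⟩ := Finset.card_pos.1 (show 0 < A.card by omega)
  have hT : ∀ e ∈ A ∪ C, e ∈ G.edgeSet := fun e he =>
    mem_edgeFinset.1 ((Finset.mem_union.1 he).elim (fun h => hA₀ h) (fun h => hC₀ h))
  obtain ⟨x, y, z, hxy, hx, hz⟩ := hG.exists_penultimate hT ⟨a₀, by simp [ha₀]⟩
  simp only [Finset.mem_union] at hxy hx hz
  -- an edge that meets a pendant edge at `y` contains `y`
  have hmeet : ∀ u, (∀ e, e ∈ A ∨ e ∈ C → u ∈ e → e = s(u, y)) →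
      ∀ e, e ∈ A ∨ e ∈ C → EdgesMeet e s(u, y) → y ∈ e := by
    rintro u hu e he ⟨t, hte, ht⟩
    rcases Sym2.mem_iff.1 ht with rfl | rfl
    · rw [hu e he hte]
      simp
    · exact hte
  have hsymm : ∀ e e' : Sym2 V, EdgesMeet e e' → EdgesMeet e' e := fun e e' ⟨t, h, h'⟩ => ⟨t, h', h⟩
  by_cases hpend : ∃ u, s(u, y) ∈ A ∧ ∀ e, e ∈ A ∨ e ∈ C → u ∈ e → e = s(u, y)
  · obtain ⟨u, huA, hu⟩ := hpend
    by_cases hex : ∃ a ∈ A, a ≠ s(u, y) ∧ y ∈ a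
    · obtain ⟨a, ha, hau, hya⟩ := hex
      exact Or.inl ⟨_, huA, a, ha, hau, fun c hc huc =>
        ⟨y, hya, hmeet u hu c (Or.inr hc) (hsymm _ _ huc)⟩⟩
    push Not at hex
    by_cases hpendC : ∃ t, s(t, y) ∈ C ∧ ∀ e, e ∈ A ∨ e ∈ C → t ∈ e → e = s(t, y)
    · obtain ⟨t, htC, ht⟩ := hpendC
      exact Or.inr ⟨_, htC, _, huA, fun b hb hbt => by_contra fun hne =>
        hex b hb hne (hmeet t ht b (Or.inl hb) hbt)⟩
    · -- the only constraint at `y` is the edge `zy`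
      have hall : ∀ c ∈ C, EdgesMeet s(u, y) c → c = s(z, y) := by
        intro c hc huc
        obtain ⟨t, rfl⟩ := hmeet u hu c (Or.inr hc) (hsymm _ _ huc)
        rw [Sym2.eq_swap] at hc ⊢
        by_contra hne
        exact hpendC ⟨t, hc, hz t (Or.inr hc) (fun h => hne (by rw [h]))⟩
      by_cases hex' : ∃ a ∈ A, a ≠ s(u, y) ∧ EdgesMeet a s(z, y)
      · obtain ⟨a, ha, hau, hmz⟩ := hex'
        exact Or.inl ⟨_, huA, a, ha, hau, fun c hc huc => hall c hc huc ▸ hmz⟩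
      push Not at hex'
      by_cases hzC : s(z, y) ∈ C
      · exact Or.inr ⟨_, hzC, _, huA, fun b hb hbz => by_contra fun hne => hex' b hb hne hbz⟩
      · obtain ⟨a, ha, hau⟩ := Finset.exists_mem_ne hA s(u, y)
        exact Or.inl ⟨_, huA, a, ha, hau, fun c hc huc =>
          absurd (hall c hc huc ▸ hc) hzC⟩
  · -- `xy` is a constraint, and only the edge `zy` of `A` can meet it
    have hxC : s(x, y) ∈ C := hxy.resolve_left fun h => hpend ⟨x, h, hx⟩
    have hall : ∀ b ∈ A, EdgesMeet b s(x, y) → b = s(z, y) := by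
      intro b hb hbx
      obtain ⟨t, rfl⟩ := hmeet x hx b (Or.inl hb) hbx
      rw [Sym2.eq_swap] at hb ⊢
      by_contra hne
      exact hpend ⟨t, hb, hz t (Or.inl hb) (fun h => hne (by rw [h]))⟩
    by_cases hzA : s(z, y) ∈ A
    · exact Or.inr ⟨_, hxC, _, hzA, hall⟩
    · exact Or.inr ⟨_, hxC, a₀, ha₀, fun b hb hbx => absurd (hall b hb hbx ▸ hb) hzA⟩

end Fintype

/-! ### Removing a leaf and its neighbour -/

section EdgesWithin

variable [Fintype V] [DecidableEq V] [DecidableRel G.Adj]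

variable (G) in
open Classical in
/-- The edges of the subgraph of `G` induced on `S`. -/
noncomputable def edgesWithin (S : Finset V) : Finset (Sym2 V) :=
  G.edgeFinset.filter fun e => ∀ x ∈ e, x ∈ S

theorem mem_edgesWithin {S : Finset V} {e : Sym2 V} :
    e ∈ G.edgesWithin S ↔ e ∈ G.edgeSet ∧ ∀ x ∈ e, x ∈ S := by
  simp [edgesWithin]

theorem mk_mem_edgesWithin {S : Finset V} {x y : V} :
    s(x, y) ∈ G.edgesWithin S ↔ G.Adj x y ∧ x ∈ S ∧ y ∈ S := by
  simp [mem_edgesWithin]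

theorem edgesWithin_mono {S T : Finset V} (h : S ⊆ T) : G.edgesWithin S ⊆ G.edgesWithin T :=
  fun e he => by
    rw [mem_edgesWithin] at he ⊢
    exact ⟨he.1, fun x hx => h (he.2 x hx)⟩

theorem edgesWithin_univ : G.edgesWithin Finset.univ = G.edgeFinset := by
  ext e
  simp [mem_edgesWithin]

theorem edgesWithin_empty : G.edgesWithin ∅ = ∅ := by
  refine Finset.eq_empty_of_forall_notMem fun e he => ?_
  induction e using Sym2.ind with
  | _ x y => simp [mk_mem_edgesWithin] at he

variable (G) in
/-- `v` is a leaf of the subgraph of `G` induced on `S`, with neighbour `w`. -/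
structure IsLeafWithin (S : Finset V) (v w : V) : Prop where
  mem_left : v ∈ S
  mem_right : w ∈ S
  adj : G.Adj v w
  unique : ∀ u ∈ S, G.Adj v u → u = w

variable {S : Finset V} {v w : V}

theorem IsLeafWithin.edge_mem (h : G.IsLeafWithin S v w) : s(v, w) ∈ G.edgesWithin S :=
  mk_mem_edgesWithin.2 ⟨h.adj, h.mem_left, h.mem_right⟩

theorem IsLeafWithin.eq_of_mem (h : G.IsLeafWithin S v w) {e : Sym2 V}
    (he : e ∈ G.edgesWithin S) (hv : v ∈ e) : e = s(v, w) := by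
  obtain ⟨u, rfl⟩ := hv
  rw [mk_mem_edgesWithin] at he
  rw [h.unique u he.2.2 he.1]

theorem IsLeafWithin.edgesWithin_erase (h : G.IsLeafWithin S v w) :
    G.edgesWithin ((S.erase w).erase v) = (G.edgesWithin S).filter fun e => w ∉ e := by
  ext e
  rw [Finset.mem_filter]
  constructor
  · intro he
    refine ⟨edgesWithin_mono ((Finset.erase_subset _ _).trans (Finset.erase_subset _ _)) he, ?_⟩
    intro hw
    have := (mem_edgesWithin.1 he).2 w hw
    simp at this
  · rintro ⟨he, hw⟩
    refine mem_edgesWithin.2 ⟨(mem_edgesWithin.1 he).1, fun x hx => ?_⟩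
    refine Finset.mem_erase.2 ⟨?_, Finset.mem_erase.2 ⟨?_, (mem_edgesWithin.1 he).2 x hx⟩⟩
    · rintro rfl
      exact hw (by simp [h.eq_of_mem he hx])
    · rintro rfl
      exact hw hx

omit [Fintype V] [DecidableRel G.Adj] in
/-- The apex over the suspension point `w` is `v`; without `w`, the constraint at `v` says that `v` is
in no face. -/
theorem IsLeafWithin.hasSphereType_dominatesVertex [Countable V] (h : G.IsLeafWithin S v w) {k : ℕ}
    (hk : HasSphereType (coveringComplex G.DominatesVertex ((S.erase w).erase v)
      ((S.erase w).erase v)).faces k) :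
    HasSphereType (coveringComplex G.DominatesVertex S S).faces (k + 1) := by
  have hvw := h.adj.ne
  have key := HasSphereType.of_sdiff (R := G.DominatesVertex) (A := S) (C := S) {w}
    (Finset.singleton_subset_iff.2 h.mem_right) (n := k)
  rw [Finset.card_singleton] at key
  refine key ?_ ?_
  · intro a ha
    rw [Finset.mem_singleton] at ha
    subst ha
    refine ⟨v, by simp [h.mem_left, hvw], fun c hc hvc => ?_⟩
    rcases hvc with rfl | hvc
    · exact Or.inr h.adj.symm
    · exact Or.inl (h.unique c hc hvc).symm
  · convert hk using 1
    ext F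
    constructor
    · rintro ⟨hF, hcov⟩
      have hvF : v ∉ F := by
        obtain ⟨a, ha, haF, rfl | hav⟩ := hcov v h.mem_left
        · exact haF
        · have := h.unique a (Finset.mem_sdiff.1 ha).1 hav.symm
          simp [this] at ha
      refine ⟨fun x hx => ?_, fun c hc => ?_⟩
      · have := hF hx
        simp only [Finset.mem_sdiff, Finset.mem_singleton] at this
        exact Finset.mem_erase.2 ⟨fun h => hvF (h ▸ hx), Finset.mem_erase.2 ⟨this.2, this.1⟩⟩
      · simp only [Finset.mem_erase] at hc
        obtain ⟨a, ha, haF, hac⟩ := hcov c hc.2.2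
        simp only [Finset.mem_sdiff, Finset.mem_singleton] at ha
        refine ⟨a, ?_, haF, hac⟩
        refine Finset.mem_erase.2 ⟨?_, Finset.mem_erase.2 ⟨ha.2, ha.1⟩⟩
        rintro rfl
        rcases hac with rfl | hac
        · exact hc.1 rfl
        · exact hc.2.1 (h.unique c hc.2.2 hac)
    · rintro ⟨hF, hcov⟩
      have hvF : v ∉ F := fun hv => by simpa using hF hv
      refine ⟨fun x hx => ?_, fun c hc => ?_⟩
      · have := hF hx
        simp only [Finset.mem_erase] at this
        simp [this]
      · have hvm : v ∈ S \ {w} := by simp [h.mem_left, hvw]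
        by_cases hcv : c = v
        · exact ⟨v, hvm, hvF, Or.inl hcv.symm⟩
        by_cases hcw : c = w
        · exact ⟨v, hvm, hvF, Or.inr (hcw ▸ h.adj)⟩
        obtain ⟨a, ha, haF, hac⟩ := hcov c (by simp [hc, hcv, hcw])
        simp only [Finset.mem_erase] at ha
        exact ⟨a, by simp [ha], haF, hac⟩

/-- All edges at `w` other than `vw` are suspension points over the apex `vw`. Once they are
removed, `vw` lies in no face, and it meets all edges at `w`. -/
theorem IsLeafWithin.hasSphereType_edgesMeet (h : G.IsLeafWithin S v w) {n : ℕ}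
    (hn : HasSphereType (coveringComplex EdgesMeet (G.edgesWithin ((S.erase w).erase v))
      (G.edgesWithin ((S.erase w).erase v))).faces n) :
    ∃ m, HasSphereType (coveringComplex EdgesMeet (G.edgesWithin S) (G.edgesWithin S)).faces m ∧
      m + (G.edgesWithin ((S.erase w).erase v)).card + 1 = n + (G.edgesWithin S).card := by
  have hE := h.edgesWithin_erase
  set E := G.edgesWithin S with hEdef
  have hmem : ∀ e, e ∈ G.edgesWithin ((S.erase w).erase v) ↔ e ∈ E ∧ w ∉ e := fun e => by
    rw [hE, Finset.mem_filter]
  have hmeet : ∀ e ∈ E, EdgesMeet e s(v, w) → w ∈ e := by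
    rintro e he ⟨x, hxe, hx⟩
    rcases Sym2.mem_iff.1 hx with rfl | rfl
    · rw [h.eq_of_mem he hxe]
      simp
    · exact hxe
  set Q : Finset (Sym2 V) := (E.filter fun e => w ∈ e).erase s(v, w) with hQ
  have hQmem : ∀ e, e ∈ Q ↔ e ≠ s(v, w) ∧ e ∈ E ∧ w ∈ e := fun e => by
    rw [hQ, Finset.mem_erase, Finset.mem_filter]
  have hcard : Q.card + 1 + (G.edgesWithin ((S.erase w).erase v)).card = E.card := by
    rw [hQ, Finset.card_erase_add_one (by simp [hEdef, h.edge_mem]), hE]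
    exact Finset.card_filter_add_card_filter_not _
  refine ⟨n + Q.card, HasSphereType.of_sdiff Q (fun e he => ((hQmem e).1 he).2.1) ?_ ?_, by omega⟩
  · intro a ha
    refine ⟨s(v, w), ?_, fun c hc hvc => ?_⟩
    · rw [Finset.mem_sdiff, hQmem]
      exact ⟨h.edge_mem, fun h => h.1 rfl⟩
    · obtain ⟨x, hx, hxc⟩ := hvc
      exact ⟨w, ((hQmem a).1 ha).2.2, hmeet c hc ⟨x, hxc, hx⟩⟩
  · have hsd : ∀ e, e ∈ E \ Q ↔ e = s(v, w) ∨ e ∈ E ∧ w ∉ e := by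
      intro e
      rw [Finset.mem_sdiff, hQmem]
      constructor
      · tauto
      · rintro (rfl | he)
        · exact ⟨h.edge_mem, by tauto⟩
        · exact ⟨he.1, by tauto⟩
    convert hn using 1
    ext F
    constructor
    · rintro ⟨hF, hcov⟩
      have hvF : s(v, w) ∉ F := by
        obtain ⟨a, ha, haF, hav⟩ := hcov _ h.edge_mem
        have hwa := hmeet a (Finset.mem_sdiff.1 ha).1 hav
        rcases (hsd a).1 ha with rfl | ha
        · exact haF
        · exact absurd hwa ha.2
      refine ⟨fun e he => ?_, fun c hc => ?_⟩
      · rw [hmem]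
        exact ((hsd e).1 (hF he)).resolve_left fun h => hvF (h ▸ he)
      · rw [hmem] at hc
        obtain ⟨a, ha, haF, hac⟩ := hcov c hc.1
        refine ⟨a, ?_, haF, hac⟩
        rw [hmem]
        refine ((hsd a).1 ha).resolve_left ?_
        rintro rfl
        obtain ⟨x, hx, hxc⟩ := hac
        exact hc.2 (hmeet c hc.1 ⟨x, hxc, hx⟩)
    · rintro ⟨hF, hcov⟩
      refine ⟨fun e he => (hsd e).2 (Or.inr ((hmem e).1 (hF he))), fun c hc => ?_⟩
      by_cases hwc : w ∈ c
      · exact ⟨s(v, w), (hsd _).2 (Or.inl rfl), fun h => ((hmem _).1 (hF h)).2 (by simp),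
          w, by simp, hwc⟩
      · obtain ⟨a, ha, haF, hac⟩ := hcov c ((hmem c).2 ⟨hc, hwc⟩)
        exact ⟨a, (hsd a).2 (Or.inr ((hmem a).1 ha)), haF, hac⟩

variable (G) in
/-- The vertices of `B` outside the closed neighbourhood of `w`. -/
def awayFrom (B : Finset V) (w : V) : Finset V :=
  B.filter fun u => u ≠ w ∧ ¬ G.Adj w u

omit [Fintype V] in
theorem mem_awayFrom {u : V} : u ∈ G.awayFrom S w ↔ u ∈ S ∧ u ≠ w ∧ ¬ G.Adj w u :=
  Finset.mem_filter

omit [Fintype V] in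
theorem awayFrom_subset : G.awayFrom S w ⊆ S := Finset.filter_subset _ _

omit [Fintype V] in
theorem IsLeafWithin.ne_of_mem_awayFrom (h : G.IsLeafWithin S v w) {u : V}
    (hu : u ∈ G.awayFrom S w) : u ≠ v := by
  rintro rfl
  exact (mem_awayFrom.1 hu).2.2 h.adj.symm

/-- The apex over the suspension point `w` is `v`. In the link of `w`, no neighbour of `w` is a
vertex. -/
theorem IsLeafWithin.faces_independence (h : G.IsLeafWithin S v w) :
    (coveringComplex (fun (v : V) (e : Sym2 V) => v ∈ e) (S \ {w}) (G.edgesWithin S)).faces =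
      (coveringComplex (fun (v : V) (e : Sym2 V) => v ∈ e) (G.awayFrom S w)
        (G.edgesWithin (G.awayFrom S w))).faces := by
  ext F
  constructor
  · rintro ⟨hF, hcov⟩
    have hnb : ∀ u ∈ S, G.Adj w u → u ∉ F := by
      intro u hu hadj
      obtain ⟨a, ha, haF, hae⟩ := hcov s(w, u) (mk_mem_edgesWithin.2 ⟨hadj, h.mem_right, hu⟩)
      simp only [Finset.mem_sdiff, Finset.mem_singleton] at ha
      rwa [← (Sym2.mem_iff.1 hae).resolve_left ha.2]
    refine ⟨fun x hx => ?_, fun c hc => ?_⟩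
    · have := hF hx
      simp only [Finset.mem_sdiff, Finset.mem_singleton] at this
      exact mem_awayFrom.2 ⟨this.1, this.2, fun hadj => hnb x this.1 hadj hx⟩
    · obtain ⟨a, -, haF, hac⟩ := hcov c (edgesWithin_mono awayFrom_subset hc)
      exact ⟨a, (mem_edgesWithin.1 hc).2 a hac, haF, hac⟩
  · rintro ⟨hF, hcov⟩
    refine ⟨fun x hx => ?_, fun c hc => ?_⟩
    · have := mem_awayFrom.1 (hF hx)
      simp [this.1, this.2.1]
    · by_cases hc' : c ∈ G.edgesWithin (G.awayFrom S w)
      · obtain ⟨a, ha, haF, hac⟩ := hcov c hc'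
        have := mem_awayFrom.1 ha
        exact ⟨a, by simp [this.1, this.2.1], haF, hac⟩
      -- one endpoint of `c` lies in the closed neighbourhood of `w`
      rw [mem_edgesWithin] at hc hc'
      by_cases hwc : w ∈ c
      · obtain ⟨u, rfl⟩ := hwc
        have hadj : G.Adj w u := hc.1
        exact ⟨u, by simp [hc.2 u (by simp), hadj.ne'],
          fun huF => (mem_awayFrom.1 (hF huF)).2.2 hadj, by simp⟩
      · push Not at hc'
        obtain ⟨x, hxc, hx⟩ := hc' hc.1
        have hxw : x ≠ w := fun h => hwc (h ▸ hxc)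
        exact ⟨x, by simp [hc.2 x hxc, hxw], fun hxF => hx (hF hxF), hxc⟩

theorem IsLeafWithin.apex_independence (h : G.IsLeafWithin S v w) :
    ∀ a ∈ ({w} : Finset V), ∃ x ∈ S \ {w}, ∀ c ∈ G.edgesWithin S, x ∈ c → a ∈ c := by
  intro a ha
  rw [Finset.mem_singleton] at ha
  subst ha
  exact ⟨v, by simp [h.mem_left, h.adj.ne], fun c hc hvc => by simp [h.eq_of_mem hc hvc]⟩

variable (G) in
/-- The edges in `S` not at `w` that meet the neighbourhood of `w`: the suspension points that occur
when the edge covering complex is reduced along a leaf with neighbour `w`. -/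
noncomputable def edgesNear (S : Finset V) (w : V) : Finset (Sym2 V) :=
  (G.edgesWithin S).filter fun e => w ∉ e ∧ e ∉ G.edgesWithin (G.awayFrom S w)

theorem mem_edgesNear {e : Sym2 V} : e ∈ G.edgesNear S w ↔
    e ∈ G.edgesWithin S ∧ w ∉ e ∧ e ∉ G.edgesWithin (G.awayFrom S w) :=
  Finset.mem_filter

theorem edgesNear_subset :
    G.edgesNear S w ⊆ (G.edgesWithin S).erase s(v, w) := fun e he => by
  rw [mem_edgesNear] at he
  refine Finset.mem_erase.2 ⟨?_, he.1⟩
  rintro rfl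
  simp at he

/-- The edge `vw` is in no face and covers both `v` and `w`. -/
theorem IsLeafWithin.faces_edgeCovering (h : G.IsLeafWithin S v w) :
    (coveringComplex (fun (e : Sym2 V) (v : V) => v ∈ e) (G.edgesWithin S) S).faces =
      (coveringComplex (fun (e : Sym2 V) (v : V) => v ∈ e) ((G.edgesWithin S).erase s(v, w))
        ((S.erase w).erase v)).faces := by
  ext F
  constructor
  · rintro ⟨hF, hcov⟩
    have hvF : s(v, w) ∉ F := by
      obtain ⟨a, ha, haF, hva⟩ := hcov v h.mem_left
      rwa [← h.eq_of_mem ha hva]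
    refine ⟨Finset.subset_erase.2 ⟨hF, hvF⟩, fun c hc => ?_⟩
    simp only [Finset.mem_erase] at hc
    obtain ⟨a, ha, haF, hac⟩ := hcov c hc.2.2
    refine ⟨a, Finset.mem_erase.2 ⟨?_, ha⟩, haF, hac⟩
    rintro rfl
    rcases Sym2.mem_iff.1 hac with rfl | rfl <;> simp at hc
  · rintro ⟨hF, hcov⟩
    rw [Finset.subset_erase] at hF
    refine ⟨hF.1, fun c hc => ?_⟩
    by_cases hcv : c = v
    · exact ⟨_, h.edge_mem, hF.2, by simp [hcv]⟩
    by_cases hcw : c = w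
    · exact ⟨_, h.edge_mem, hF.2, by simp [hcw]⟩
    obtain ⟨a, ha, haF, hac⟩ := hcov c (by simp [hc, hcv, hcw])
    exact ⟨a, Finset.mem_of_mem_erase ha, haF, hac⟩

/-- An edge `zu` with `z` a neighbour of `w` is a suspension point over the apex `wz`. -/
theorem IsLeafWithin.apex_edgeCovering (h : G.IsLeafWithin S v w) :
    ∀ a ∈ G.edgesNear S w, ∃ e ∈ (G.edgesWithin S).erase s(v, w) \ G.edgesNear S w,
      ∀ c ∈ (S.erase w).erase v, c ∈ e → c ∈ a := by
  intro a ha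
  obtain ⟨haS, hwa, haw⟩ := mem_edgesNear.1 ha
  rw [mem_edgesWithin] at haw
  push Not at haw
  obtain ⟨z, hza, hz⟩ := haw (mem_edgesWithin.1 haS).1
  have hzS := (mem_edgesWithin.1 haS).2 z hza
  have hzw : z ≠ w := fun h => hwa (h ▸ hza)
  have hzv : z ≠ v := by
    rintro rfl
    exact hwa (by simp [h.eq_of_mem haS hza])
  have hadj : G.Adj w z := by
    by_contra hadj
    exact hz (mem_awayFrom.2 ⟨hzS, hzw, hadj⟩)
  refine ⟨s(w, z), ?_, ?_⟩
  · simp only [Finset.mem_sdiff, Finset.mem_erase, mem_edgesNear, mk_mem_edgesWithin]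
    refine ⟨⟨fun heq => hzv ?_, hadj, h.mem_right, hzS⟩, by simp⟩
    rwa [Sym2.eq_swap, Sym2.congr_left] at heq
  · intro c hc hcz
    simp only [Finset.mem_erase] at hc
    rwa [(Sym2.mem_iff.1 hcz).resolve_left hc.2.1]

/-- After the removal of all suspension points, the edges `wz` are in no face, as each is the only
edge left at `z`; they cover the neighbours of `w`. -/
theorem IsLeafWithin.faces_edgeCovering_awayFrom (h : G.IsLeafWithin S v w) :
    (coveringComplex (fun (e : Sym2 V) (v : V) => v ∈ e)
      ((G.edgesWithin S).erase s(v, w) \ G.edgesNear S w) ((S.erase w).erase v)).faces =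
    (coveringComplex (fun (e : Sym2 V) (v : V) => v ∈ e) (G.edgesWithin (G.awayFrom S w))
      (G.awayFrom S w)).faces := by
  have hE' : ∀ e ∈ G.edgesWithin (G.awayFrom S w), w ∉ e := fun e he hwe =>
    (mem_awayFrom.1 ((mem_edgesWithin.1 he).2 w hwe)).2.1 rfl
  have hsd : ∀ e, e ∈ (G.edgesWithin S).erase s(v, w) \ G.edgesNear S w ↔
      e ∈ G.edgesWithin (G.awayFrom S w) ∨ (e ∈ G.edgesWithin S ∧ w ∈ e ∧ e ≠ s(v, w)) := by
    intro e
    rw [Finset.mem_sdiff, Finset.mem_erase, mem_edgesNear]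
    constructor
    · rintro ⟨⟨h1, h2⟩, h3⟩
      by_cases hwe : w ∈ e
      · exact Or.inr ⟨h2, hwe, h1⟩
      · exact Or.inl (by_contra fun h4 => h3 ⟨h2, hwe, h4⟩)
    · rintro (he | he)
      · refine ⟨⟨?_, edgesWithin_mono awayFrom_subset he⟩, fun h => h.2.2 he⟩
        rintro rfl
        exact hE' _ he (by simp)
      · exact ⟨⟨he.2.2, he.1⟩, fun h => h.2.1 he.2.1⟩
  ext F
  constructor
  · rintro ⟨hF, hcov⟩
    refine ⟨fun e he => ?_, fun c hc => ?_⟩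
    · rcases (hsd e).1 (hF he) with h' | ⟨heS, hwe, hne⟩
      · exact h'
      · exfalso
        -- `e = wz`, and `z` is covered by no other edge
        obtain ⟨z, rfl⟩ := hwe
        have hz := mk_mem_edgesWithin.1 heS
        have hzv : z ≠ v := by
          rintro rfl
          exact hne Sym2.eq_swap
        obtain ⟨a, ha, haF, hza⟩ := hcov z (by simp [hzv, hz.1.ne', hz.2.2])
        rcases (hsd a).1 ha with ha | ⟨-, hwa, -⟩
        · exact (mem_awayFrom.1 ((mem_edgesWithin.1 ha).2 z hza)).2.2 hz.1
        · refine haF ?_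
          rwa [(Sym2.mem_and_mem_iff hz.1.ne).1 ⟨hwa, hza⟩]
    · have hc' := mem_awayFrom.1 hc
      obtain ⟨a, ha, haF, hca⟩ := hcov c (by simp [hc'.1, hc'.2.1, h.ne_of_mem_awayFrom hc])
      refine ⟨a, ((hsd a).1 ha).resolve_right ?_, haF, hca⟩
      rintro ⟨haS, hwa, -⟩
      rw [(Sym2.mem_and_mem_iff hc'.2.1.symm).1 ⟨hwa, hca⟩, mk_mem_edgesWithin] at haS
      exact hc'.2.2 haS.1
  · rintro ⟨hF, hcov⟩
    refine ⟨fun e he => (hsd e).2 (Or.inl (hF he)), fun c hc => ?_⟩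
    simp only [Finset.mem_erase] at hc
    by_cases hc' : c ∈ G.awayFrom S w
    · obtain ⟨a, ha, haF, hca⟩ := hcov c hc'
      exact ⟨a, (hsd a).2 (Or.inl ha), haF, hca⟩
    · have hadj : G.Adj w c := by
        by_contra hadj
        exact hc' (mem_awayFrom.2 ⟨hc.2.2, hc.2.1, hadj⟩)
      refine ⟨s(w, c), (hsd _).2 (Or.inr ⟨mk_mem_edgesWithin.2 ⟨hadj, h.mem_right, hc.2.2⟩, by simp,
        fun heq => hc.1 ?_⟩), fun hcF => hE' _ (hF hcF) (by simp), by simp⟩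
      rwa [Sym2.eq_swap, Sym2.congr_left] at heq

/-- The closed neighbourhood of `w` has one vertex more than there are edges at `w`. -/
theorem card_edgesWithin_awayFrom (hw : w ∈ S) :
    (G.edgesWithin S).card + (G.awayFrom S w).card + 1 =
      (G.edgesWithin (G.awayFrom S w)).card + (G.edgesNear S w).card + S.card := by
  set Z := S.filter fun u => G.Adj w u with hZ
  have h1 : S.card = (G.awayFrom S w).card + 1 + Z.card := by
    have h1 := Finset.card_filter_add_card_filter_not (s := S.erase w) (fun u => G.Adj w u)
    have h2 := Finset.card_erase_add_one hw
    have h3 : (S.erase w).filter (fun u => G.Adj w u) = Z := by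
      ext u
      simp only [Finset.mem_filter, Finset.mem_erase, hZ]
      exact ⟨fun h => ⟨h.1.2, h.2⟩, fun h => ⟨⟨h.2.ne', h.1⟩, h.2⟩⟩
    have h4 : (S.erase w).filter (fun u => ¬ G.Adj w u) = G.awayFrom S w := by
      ext u
      simp only [Finset.mem_filter, Finset.mem_erase, mem_awayFrom]
      tauto
    rw [h3, h4] at h1
    omega
  have h2 := Finset.card_filter_add_card_filter_not (s := G.edgesWithin S) (fun e => w ∈ e)
  have h3 : ((G.edgesWithin S).filter fun e => w ∈ e).card = Z.card := by
    rw [← Finset.card_image_of_injective Z (f := fun u => s(w, u))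
      fun x y h => Sym2.congr_right.1 h]
    congr 1
    ext e
    simp only [Finset.mem_filter, Finset.mem_image, hZ]
    constructor
    · rintro ⟨he, u, rfl⟩
      rw [mk_mem_edgesWithin] at he
      exact ⟨u, ⟨he.2.2, he.1⟩, rfl⟩
    · rintro ⟨u, hu, rfl⟩
      exact ⟨mk_mem_edgesWithin.2 ⟨hu.2, hw, hu.1⟩, by simp⟩
  have h4 : ((G.edgesWithin S).filter fun e => w ∉ e).card =
      (G.edgesWithin (G.awayFrom S w)).card + (G.edgesNear S w).card := by
    rw [← Finset.card_union_of_disjoint]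
    · congr 1
      ext e
      rw [Finset.mem_filter, Finset.mem_union, mem_edgesNear]
      constructor
      · rintro ⟨he, hwe⟩
        by_cases he' : e ∈ G.edgesWithin (G.awayFrom S w)
        · exact Or.inl he'
        · exact Or.inr ⟨he, hwe, he'⟩
      · rintro (he | he)
        · exact ⟨edgesWithin_mono awayFrom_subset he, fun hwe =>
            (mem_awayFrom.1 ((mem_edgesWithin.1 he).2 w hwe)).2.1 rfl⟩
        · exact ⟨he.1, he.2.1⟩
    · exact Finset.disjoint_left.2 fun e he he' => (mem_edgesNear.1 he').2.2 he
  omega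

end EdgesWithin

/-! ### Homotopy types -/

section Main

variable [Fintype V] [DecidableEq V] [DecidableRel G.Adj]

/-- Removing a leaf `v` and its neighbour `w` from a forest lowers the vertex cover number by one,
desuspends the dominance complex once, and desuspends the edge dominance complex once for each edge
at `w` other than `vw`. -/
theorem IsAcyclic.exists_sphereType_dominance (hG : G.IsAcyclic) (S : Finset V) :
    ∃ k n, HasSphereType (coveringComplex G.DominatesVertex S S).faces k ∧
      HasSphereType (coveringComplex EdgesMeet (G.edgesWithin S) (G.edgesWithin S)).faces n ∧
      n + k = (G.edgesWithin S).card ∧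
      (∃ U : Finset V, U.card = k ∧ ∀ x ∈ S, ∀ y ∈ S, G.Adj x y → x ∈ U ∨ y ∈ U) ∧
      ∀ U : Finset V, (∀ x ∈ S, ∀ y ∈ S, G.Adj x y → x ∈ U ∨ y ∈ U) → k ≤ U.card := by
  induction S using Finset.strongInduction with
  | H S ih =>
  rcases S.eq_empty_or_nonempty with rfl | hne
  · have hE : G.edgesWithin ∅ = ∅ := by
      refine Finset.eq_empty_of_forall_notMem fun e he => ?_
      induction e using Sym2.ind with
      | _ x y => simp [mk_mem_edgesWithin] at he
    rw [hE]
    exact ⟨0, 0, hasSphereType_coveringComplex_empty, hasSphereType_coveringComplex_empty, by simp,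
      ⟨∅, by simp⟩, by simp⟩
  obtain ⟨v, hv, w, hw⟩ := hG.exists_leaf hne
  by_cases hwS : w ∈ S ∧ G.Adj v w
  · have h : G.IsLeafWithin S v w := ⟨hv, hwS.1, hwS.2, hw⟩
    have hss : (S.erase w).erase v ⊂ S :=
      (Finset.erase_subset _ _).trans_ssubset (Finset.erase_ssubset hwS.1)
    obtain ⟨k, n, hk, hn, hnk, ⟨U, hU, hUc⟩, hmin⟩ := ih _ hss
    obtain ⟨m, hm, hmn⟩ := h.hasSphereType_edgesMeet hn
    refine ⟨k + 1, m, h.hasSphereType_dominatesVertex hk, hm, by omega, ?_, ?_⟩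
    · have hcover : ∀ x ∈ S, ∀ y ∈ S, G.Adj x y → x ∈ insert w U ∨ y ∈ insert w U := by
        intro x hx y hy hxy
        by_cases hxw : x = w
        · simp [hxw]
        by_cases hyw : y = w
        · simp [hyw]
        have hxv : x ≠ v := by
          rintro rfl
          exact hyw (hw y hy hxy)
        have hyv : y ≠ v := by
          rintro rfl
          exact hxw (hw x hx hxy.symm)
        rcases hUc x (by simp [*]) y (by simp [*]) hxy with h | h <;> simp [h]
      have hwU : w ∉ U := by
        intro hwU
        -- otherwise `U` without `w` would be too small a cover
        have := hmin (U.erase w) fun x hx y hy hxy => by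
          simp only [Finset.mem_erase] at hx hy ⊢
          exact (hUc x (by simp [hx]) y (by simp [hy]) hxy).imp (fun h => ⟨hx.2.1, h⟩)
            fun h => ⟨hy.2.1, h⟩
        have h2 := Finset.card_erase_add_one hwU
        omega
      exact ⟨insert w U, by rw [Finset.card_insert_of_notMem hwU, hU], hcover⟩
    · intro U' hU'
      have h1 := hmin ((U'.erase w).erase v) fun x hx y hy hxy => by
        simp only [Finset.mem_erase] at hx hy ⊢
        exact (hU' x hx.2.2 y hy.2.2 hxy).imp (fun h => ⟨hx.1, hx.2.1, h⟩)
          fun h => ⟨hy.1, hy.2.1, h⟩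
      have h2 : ((U'.erase w).erase v).card < U'.card := by
        refine Finset.card_lt_card ⟨(Finset.erase_subset _ _).trans (Finset.erase_subset _ _), ?_⟩
        intro hsub
        rcases hU' v hv w hwS.1 hwS.2 with h | h
        · simpa using hsub h
        · simpa using hsub h
      omega
  · -- `v` is isolated: it lies in no face of the dominance complex, and meets no edge
    have hiso : ∀ u ∈ S, ¬ G.Adj v u := fun u hu hadj =>
      hwS (hw u hu hadj ▸ ⟨hu, hadj⟩)
    obtain ⟨k, n, hk, hn, hnk, ⟨U, hU, hUc⟩, hmin⟩ := ih _ (Finset.erase_ssubset hv)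
    have hE : G.edgesWithin (S.erase v) = G.edgesWithin S := by
      ext e
      induction e using Sym2.ind with
      | _ x y =>
        simp only [mk_mem_edgesWithin, Finset.mem_erase]
        constructor
        · exact fun h => ⟨h.1, h.2.1.2, h.2.2.2⟩
        · rintro ⟨hxy, hx, hy⟩
          refine ⟨hxy, ⟨?_, hx⟩, ?_, hy⟩
          · rintro rfl
            exact hiso y hy hxy
          · rintro rfl
            exact hiso x hx hxy.symm
    rw [hE] at hn hnk
    refine ⟨k, n, ?_, hn, hnk, ⟨U, hU, ?_⟩, ?_⟩
    · convert hk using 1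
      ext F
      constructor
      · rintro ⟨hF, hcov⟩
        have hvF : v ∉ F := by
          obtain ⟨a, ha, haF, rfl | hav⟩ := hcov v hv
          · exact haF
          · exact absurd hav.symm (hiso a ha)
        refine ⟨Finset.subset_erase.2 ⟨hF, hvF⟩, fun c hc => ?_⟩
        rw [Finset.mem_erase] at hc
        obtain ⟨a, ha, haF, hac⟩ := hcov c hc.2
        refine ⟨a, Finset.mem_erase.2 ⟨?_, ha⟩, haF, hac⟩
        rintro rfl
        rcases hac with rfl | hac
        · exact hc.1 rfl
        · exact hiso c hc.2 hac
      · rintro ⟨hF, hcov⟩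
        rw [Finset.subset_erase] at hF
        refine ⟨hF.1, fun c hc => ?_⟩
        by_cases hcv : c = v
        · exact ⟨v, hv, hF.2, Or.inl hcv.symm⟩
        · obtain ⟨a, ha, haF, hac⟩ := hcov c (Finset.mem_erase.2 ⟨hcv, hc⟩)
          exact ⟨a, Finset.mem_of_mem_erase ha, haF, hac⟩
    · intro x hx y hy hxy
      refine hUc x (Finset.mem_erase.2 ⟨?_, hx⟩) y (Finset.mem_erase.2 ⟨?_, hy⟩) hxy
      · rintro rfl
        exact hiso y hy hxy
      · rintro rfl
        exact hiso x hx hxy.symm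
    · exact fun U' hU' => hmin U' fun x hx y hy => hU' x (Finset.mem_of_mem_erase hx) y
        (Finset.mem_of_mem_erase hy)

/-- The independence and edge covering complexes of the subgraph induced on `B`. The vertices of
the larger set `S` are allowed in dominating sets of `B`, but need not be dominated themselves; this
is what remains of the domination problem once a vertex `w` adjacent to a leaf has been put into the
dominating set: `w` and its leaf leave `S`, and the neighbours of `w` leave `B`. -/
theorem IsAcyclic.exists_sphereType_independence (hG : G.IsAcyclic) (S : Finset V) :
    ∀ B ⊆ S,
    (HasVoidType (coveringComplex (fun (v : V) (e : Sym2 V) => v ∈ e) B (G.edgesWithin B)).faces ∧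
      HasVoidType (coveringComplex (fun (e : Sym2 V) (v : V) => v ∈ e) (G.edgesWithin B) B).faces) ∨
    ∃ k n,
      HasSphereType (coveringComplex (fun (v : V) (e : Sym2 V) => v ∈ e) B
        (G.edgesWithin B)).faces k ∧
      HasSphereType (coveringComplex (fun (e : Sym2 V) (v : V) => v ∈ e)
        (G.edgesWithin B) B).faces n ∧
      n + B.card = (G.edgesWithin B).card + k ∧
      (∃ I ⊆ B, G.IsIndepSet (I : Set V) ∧ (∀ b ∈ B, ∃ d ∈ I, G.DominatesVertex d b) ∧ I.card = k) ∧
      ∀ D ⊆ S, (∀ b ∈ B, ∃ d ∈ D, G.DominatesVertex d b) → k ≤ D.card := by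
  induction S using Finset.strongInduction with
  | H S ih =>
  intro B hB
  rcases S.eq_empty_or_nonempty with rfl | hne
  · obtain rfl := Finset.subset_empty.1 hB
    rw [edgesWithin_empty]
    exact Or.inr ⟨0, 0, hasSphereType_coveringComplex_empty, hasSphereType_coveringComplex_empty,
      by simp, ⟨∅, by simp⟩, by simp⟩
  obtain ⟨v, hv, w, hw⟩ := hG.exists_leaf hne
  by_cases hvB : v ∈ B
  · by_cases hwB : w ∈ B ∧ G.Adj v w
    · have h : G.IsLeafWithin B v w := ⟨hvB, hwB.1, hwB.2, fun u hu => hw u (hB hu)⟩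
      have hsub : G.awayFrom B w ⊆ (S.erase w).erase v := fun u hu =>
        Finset.mem_erase.2 ⟨h.ne_of_mem_awayFrom hu,
          Finset.mem_erase.2 ⟨(mem_awayFrom.1 hu).2.1, hB (awayFrom_subset hu)⟩⟩
      have hss : (S.erase w).erase v ⊂ S :=
        (Finset.erase_subset _ _).trans_ssubset (Finset.erase_ssubset (hB hwB.1))
      rcases ih _ hss _ hsub with ⟨hI, hC⟩ | ⟨k, n, hI, hC, hkn, ⟨I, hIB, hind, hdom, hcard⟩, hmin⟩
      · left
        constructor
        · refine HasVoidType.of_sdiff {w} (Finset.singleton_subset_iff.2 hwB.1)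
            h.apex_independence ?_
          rwa [h.faces_independence]
        · rw [h.faces_edgeCovering]
          refine HasVoidType.of_sdiff (G.edgesNear B w) edgesNear_subset h.apex_edgeCovering ?_
          rwa [h.faces_edgeCovering_awayFrom]
      · right
        have hcount := card_edgesWithin_awayFrom (G := G) hwB.1
        refine ⟨k + 1, n + (G.edgesNear B w).card, ?_, ?_, by omega, ?_, ?_⟩
        · refine HasSphereType.of_sdiff {w} (Finset.singleton_subset_iff.2 hwB.1)
            h.apex_independence ?_
          rwa [h.faces_independence]
        · rw [h.faces_edgeCovering]
          refine HasSphereType.of_sdiff (G.edgesNear B w) edgesNear_subset h.apex_edgeCovering ?_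
          rwa [h.faces_edgeCovering_awayFrom]
        · refine ⟨insert w I, Finset.insert_subset hwB.1 (hIB.trans awayFrom_subset), ?_, ?_, ?_⟩
          · rw [Finset.coe_insert, IsIndepSet, Set.pairwise_insert]
            refine ⟨hind, fun u hu _ => ?_⟩
            have := (mem_awayFrom.1 (hIB hu)).2.2
            exact ⟨this, fun h => this h.symm⟩
          · intro b hb
            by_cases hb' : b ∈ G.awayFrom B w
            · obtain ⟨d, hd, hdb⟩ := hdom b hb'
              exact ⟨d, Finset.mem_insert_of_mem hd, hdb⟩
            · refine ⟨w, Finset.mem_insert_self _ _, ?_⟩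
              rw [mem_awayFrom] at hb'
              unfold DominatesVertex
              tauto
          · rw [Finset.card_insert_of_notMem, hcard]
            exact fun hwI => (mem_awayFrom.1 (hIB hwI)).2.1 rfl
        · intro D hD hDdom
          have h1 := hmin ((D.erase w).erase v)
            (Finset.erase_subset_erase _ (Finset.erase_subset_erase _ hD)) (by
              intro b hb
              have hb' := mem_awayFrom.1 hb
              obtain ⟨d, hd, hdb⟩ := hDdom b hb'.1
              refine ⟨d, Finset.mem_erase.2 ⟨?_, Finset.mem_erase.2 ⟨?_, hd⟩⟩, hdb⟩
              · rintro rfl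
                rcases hdb with rfl | hdb
                · exact h.ne_of_mem_awayFrom hb rfl
                · exact hb'.2.1 (hw b (hB hb'.1) hdb)
              · rintro rfl
                rcases hdb with rfl | hdb
                · exact hb'.2.1 rfl
                · exact hb'.2.2 hdb)
          -- `v` is dominated by `v` or by `w`
          have h2 : ((D.erase w).erase v).card < D.card := by
            refine Finset.card_lt_card
              ⟨(Finset.erase_subset _ _).trans (Finset.erase_subset _ _), fun hsub => ?_⟩
            obtain ⟨d, hd, rfl | hdv⟩ := hDdom v hvB
            · simpa using hsub hd
            · have := hw d (hD hd) hdv.symm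
              subst this
              simpa using hsub hd
          omega
    · -- `v` is isolated in `B`
      have hiso : ∀ u ∈ B, ¬ G.Adj v u := fun u hu hadj =>
        hwB (hw u (hB hu) hadj ▸ ⟨hu, hadj⟩)
      have hnot : ∀ e ∈ G.edgesWithin B, v ∉ e := by
        rintro e he ⟨u, rfl⟩
        rw [mk_mem_edgesWithin] at he
        exact hiso u he.2.2 he.1
      exact Or.inl ⟨hasVoidType_coveringComplex_of_apex hvB hnot,
        hasVoidType_coveringComplex_of_uncovered hvB hnot⟩
  · rcases ih _ (Finset.erase_ssubset hv) B (Finset.subset_erase.2 ⟨hB, hvB⟩) with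
      h | ⟨k, n, hI, hC, hkn, hex, hmin⟩
    · exact Or.inl h
    · refine Or.inr ⟨k, n, hI, hC, hkn, hex, fun D hD hDdom => ?_⟩
      by_cases hvD : v ∈ D
      · -- in a dominating set, `v` can be replaced by its only possible neighbour `w` in `S`
        have hcard := Finset.card_erase_add_one hvD
        have hsub : D.erase v ⊆ S.erase v := Finset.erase_subset_erase v hD
        have hdom : ∀ b ∈ B, (∃ d ∈ D.erase v, G.DominatesVertex d b) ∨ b = w ∧ G.Adj v w := by
          intro b hb
          obtain ⟨d, hd, hdb⟩ := hDdom b hb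
          by_cases hdv : d = v
          · subst hdv
            rcases hdb with rfl | hdb
            · exact absurd hb hvB
            · have := hw b (hB hb) hdb
              exact Or.inr ⟨this, this ▸ hdb⟩
          · exact Or.inl ⟨d, Finset.mem_erase.2 ⟨hdv, hd⟩, hdb⟩
        by_cases hwB : w ∈ B ∧ G.Adj v w
        · have h1 := hmin (insert w (D.erase v))
            (Finset.insert_subset (Finset.mem_erase.2 ⟨hwB.2.ne', hB hwB.1⟩) hsub) fun b hb => by
              rcases hdom b hb with ⟨d, hd, hdb⟩ | ⟨rfl, -⟩
              · exact ⟨d, Finset.mem_insert_of_mem hd, hdb⟩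
              · exact ⟨b, Finset.mem_insert_self _ _, Or.inl rfl⟩
          have h2 := Finset.card_insert_le w (D.erase v)
          omega
        · have h1 := hmin (D.erase v) hsub fun b hb =>
            (hdom b hb).resolve_right fun h => hwB ⟨h.1 ▸ hb, h.2⟩
          omega
      · exact hmin D (Finset.subset_erase.2 ⟨hD, hvD⟩) hDdom

/-- In every graph, mapping each vertex outside a dominating set `D` to an edge that joins it to `D`
is injective. -/
theorem card_le_card_edgeFinset_add_card {D : Finset V} (hD : G.IsDominatingSet D) :
    Fintype.card V ≤ G.edgeFinset.card + D.card := by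
  choose d hdD hd using hD
  have hadj : ∀ v ∈ Dᶜ, G.Adj (d v) v := fun v hv =>
    (hd v).resolve_left fun h => (Finset.mem_compl.1 hv) (h ▸ hdD v)
  have hle : (Dᶜ).card ≤ G.edgeFinset.card := by
    refine Finset.card_le_card_of_injOn (fun v => s(d v, v))
      (fun v hv => mem_edgeFinset.2 (hadj v hv)) fun x hx y hy hxy => ?_
    rcases Sym2.eq_iff.1 hxy with h | h
    · exact h.2
    · exact absurd (h.2 ▸ hdD y) (Finset.mem_compl.1 hx)
  rw [Finset.card_compl] at hle
  omega

omit [DecidableRel G.Adj] [DecidableEq V] in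
theorem exists_card_eq_dominationNum :
    ∃ D : Finset V, G.IsDominatingSet D ∧ D.card = G.dominationNum :=
  Nat.sInf_mem (s := {k | ∃ D : Finset V, G.IsDominatingSet D ∧ D.card = k})
    ⟨_, Finset.univ, fun v => ⟨v, Finset.mem_univ v, Or.inl rfl⟩, rfl⟩

omit [DecidableRel G.Adj] [DecidableEq V] in
/-- A maximal independent set is dominating, so independent dominating sets exist. -/
theorem exists_card_eq_indepDominationNum :
    ∃ D : Finset V, G.IsIndepSet (D : Set V) ∧ G.IsDominatingSet D ∧
      D.card = G.indepDominationNum := by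
  classical
  refine Nat.sInf_mem (s := {k | ∃ D : Finset V, G.IsIndepSet (D : Set V) ∧
    G.IsDominatingSet D ∧ D.card = k}) ?_
  obtain ⟨D, hD⟩ := Set.Finite.exists_maximal (s := {D : Finset V | G.IsIndepSet (D : Set V)})
    (Set.toFinite _) ⟨∅, by simp⟩
  refine ⟨_, D, hD.prop, fun v => ?_, rfl⟩
  by_contra! hv
  have hvD : v ∉ D := fun h => (hv v h).1 rfl
  refine hvD (hD.le_of_ge (y := insert v D) ?_ (Finset.subset_insert v D)
    (Finset.mem_insert_self v D))
  simp only [Set.mem_ofPred_eq, IsIndepSet, Finset.coe_insert]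
  refine (Set.pairwise_insert).2 ⟨hD.prop, fun d hd _ => ?_⟩
  exact ⟨fun h => (hv d hd).2 h.symm, (hv d hd).2⟩

theorem IsAcyclic.simpleHomotopyEquiv_dominance (hG : G.IsAcyclic) :
    G.dominanceComplex.SimpleHomotopyEquiv (crossPolytopeBoundary G.vertexCoverNum.toNat) ∧
    ∃ n : ℕ, (n : ℤ) = (G.edgeFinset.card : ℤ) - G.vertexCoverNum.toNat ∧
      G.edgeDominanceComplex.SimpleHomotopyEquiv (crossPolytopeBoundary n) := by
  classical
  obtain ⟨k, n, hk, hn, hnk, ⟨U, hUk, hU⟩, hmin⟩ := hG.exists_sphereType_dominance Finset.univ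
  have hkα : G.vertexCoverNum = k := by
    refine le_antisymm ?_ ?_
    · have : G.IsVertexCover (U : Set V) := fun x y hxy =>
        hU x (Finset.mem_univ x) y (Finset.mem_univ y) hxy
      simpa [hUk] using this.vertexCoverNum_le
    · obtain ⟨s, hs, hsc⟩ := vertexCoverNum_exists G
      rw [← hs, ← Set.coe_toFinset s, Set.encard_coe_eq_coe_finsetCard]
      exact_mod_cast hmin s.toFinset fun x _ y _ hxy => by simpa using hsc hxy
  rw [edgesWithin_univ] at hn hnk
  rw [hkα, ENat.toNat_natCast]
  exact ⟨dominanceComplex_eq (G := G) ▸ hk.simpleHomotopyEquiv, n, by omega,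
    edgeDominanceComplex_eq (G := G) ▸ hn.simpleHomotopyEquiv⟩

theorem IsAcyclic.simpleHomotopyEquiv_independence (hG : G.IsAcyclic) :
    ((G.independenceComplex.SimpleHomotopyEquiv (void V) ∨
        G.independenceComplex.SimpleHomotopyEquiv (crossPolytopeBoundary G.indepDominationNum)) ∧
      (G.independenceComplex.SimpleHomotopyEquiv (crossPolytopeBoundary G.indepDominationNum) →
        G.indepDominationNum = G.dominationNum)) ∧
    ∃ n : ℕ, (n : ℤ) = (G.edgeFinset.card : ℤ) - Fintype.card V + G.indepDominationNum ∧
      (G.edgeCoveringComplex.SimpleHomotopyEquiv (void (Sym2 V)) ∨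
        G.edgeCoveringComplex.SimpleHomotopyEquiv (crossPolytopeBoundary n)) ∧
      (G.edgeCoveringComplex.SimpleHomotopyEquiv (crossPolytopeBoundary n) →
        G.indepDominationNum = G.dominationNum) := by
  obtain ⟨D, hDind, hDdom, hDcard⟩ := G.exists_card_eq_indepDominationNum
  obtain ⟨D', hD'dom, hD'card⟩ := G.exists_card_eq_dominationNum
  have hnonneg := card_le_card_edgeFinset_add_card hDdom
  rcases hG.exists_sphereType_independence Finset.univ Finset.univ subset_rfl with
    ⟨hI, hC⟩ | ⟨k, n, hI, hC, hkn, ⟨I, -, hind, hIdom, hIk⟩, hmin⟩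
  · rw [edgesWithin_univ, ← independenceComplex_eq] at hI
    rw [edgesWithin_univ, ← edgeCoveringComplex_eq] at hC
    -- no complex is equivalent to both the void complex and a sphere
    refine ⟨⟨Or.inl hI.simpleHomotopyEquiv, fun h => absurd h
      (not_simpleHomotopyEquiv_crossPolytopeBoundary (hI.simpleHomotopyEquiv (β := V)) _)⟩,
      G.edgeFinset.card + G.indepDominationNum - Fintype.card V, by omega,
      Or.inl hC.simpleHomotopyEquiv, fun h => absurd h
      (not_simpleHomotopyEquiv_crossPolytopeBoundary (hC.simpleHomotopyEquiv (β := V)) _)⟩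
  · have hIdom' : G.IsDominatingSet I := fun v => hIdom v (Finset.mem_univ v)
    have hik : G.indepDominationNum = k := by
      refine le_antisymm (Nat.sInf_le ⟨I, hind, hIdom', hIk⟩) ?_
      rw [← hDcard]
      exact hmin D (Finset.subset_univ D) fun b _ => hDdom b
    have hγk : G.dominationNum = k := by
      refine le_antisymm (Nat.sInf_le ⟨I, hIdom', hIk⟩) ?_
      rw [← hD'card]
      exact hmin D' (Finset.subset_univ D') fun b _ => hD'dom b
    rw [edgesWithin_univ, ← independenceComplex_eq] at hI
    rw [edgesWithin_univ, ← edgeCoveringComplex_eq] at hC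
    rw [edgesWithin_univ, Finset.card_univ] at hkn
    rw [hik, hγk]
    exact ⟨⟨Or.inr hI.simpleHomotopyEquiv, fun _ => rfl⟩, n, by omega,
      Or.inr hC.simpleHomotopyEquiv, fun _ => rfl⟩

end Main

end SimpleGraph

theorem theorem6p1 {V : Type*} [Fintype V] [DecidableEq V] (G : SimpleGraph V)
    [DecidableRel G.Adj] (hG : G.IsAcyclic) :
    (G.independenceComplex.IsStrongCombinatorialGrape ∧
      G.dominanceComplex.IsStrongCombinatorialGrape ∧
      G.edgeCoveringComplex.IsStrongCombinatorialGrape ∧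
      G.edgeDominanceComplex.IsStrongCombinatorialGrape) ∧
    ((G.independenceComplex.SimpleHomotopyEquiv (GroundedComplex.void V) ∨
        G.independenceComplex.SimpleHomotopyEquiv
          (GroundedComplex.crossPolytopeBoundary G.indepDominationNum)) ∧
      (G.independenceComplex.SimpleHomotopyEquiv
          (GroundedComplex.crossPolytopeBoundary G.indepDominationNum) →
        G.indepDominationNum = G.dominationNum)) ∧
    G.dominanceComplex.SimpleHomotopyEquiv
      (GroundedComplex.crossPolytopeBoundary G.vertexCoverNum.toNat) ∧
    (∃ n : ℕ, (n : ℤ) = (G.edgeFinset.card : ℤ) - Fintype.card V + G.indepDominationNum ∧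
      (G.edgeCoveringComplex.SimpleHomotopyEquiv (GroundedComplex.void (Sym2 V)) ∨
        G.edgeCoveringComplex.SimpleHomotopyEquiv (GroundedComplex.crossPolytopeBoundary n)) ∧
      (G.edgeCoveringComplex.SimpleHomotopyEquiv (GroundedComplex.crossPolytopeBoundary n) →
        G.indepDominationNum = G.dominationNum)) ∧
    (∃ n : ℕ, (n : ℤ) = (G.edgeFinset.card : ℤ) - G.vertexCoverNum.toNat ∧
      G.edgeDominanceComplex.SimpleHomotopyEquiv (GroundedComplex.crossPolytopeBoundary n)) :=
  ⟨⟨SimpleGraph.isStrongCombinatorialGrape_independenceComplex hG,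
      SimpleGraph.isStrongCombinatorialGrape_dominanceComplex hG,
      SimpleGraph.isStrongCombinatorialGrape_edgeCoveringComplex hG,
      SimpleGraph.isStrongCombinatorialGrape_edgeDominanceComplex hG⟩,
    hG.simpleHomotopyEquiv_independence.1, hG.simpleHomotopyEquiv_dominance.1,
    hG.simpleHomotopyEquiv_independence.2, hG.simpleHomotopyEquiv_dominance.2⟩
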